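/- Let $M$ be a smooth 8-dimensional manifold with a smooth coframe $(\omega^1,\dots,\omega^8)$ and smooth functions $\tilde u_1,\dots,\tilde u_{12}$ satisfying the Monge structure equations $$\begin{aligned} d\omega^1&=2\tilde u_1\omega^1\wedge\omega^6+2\tilde u_2\omega^1\wedge\omega^7+\tilde u_2\omega^2\wedge\omega^6+\tilde u_3\omega^2\wedge\omega^7+\tilde u_4\omega^3\wedge\omega^6+\tilde u_1\omega^3\wedge\omega^7-\omega^4\wedge\omega^7-\omega^5\wedge\omega^6,\\ d\omega^2&=2\tilde u_5\omega^1\wedge\omega^6+2\tilde u_6\omega^1\wedge\omega^7+\tilde u_6\omega^2\wedge\omega^6+\tilde u_7\omega^2\wedge\omega^7+\tilde u_8\omega^3\wedge\omega^6+\tilde u_5\omega^3\wedge\omega^7-2\omega^5\wedge\omega^7,\\ d\omega^3&=2\tilde u_9\omega^1\wedge\omega^6+2\tilde u_{10}\omega^1\wedge\omega^7+\tilde u_{10}\omega^2\wedge\omega^6+\tilde u_{11}\omega^2\wedge\omega^7+\tilde u_{12}\omega^3\wedge\omega^6+\tilde u_9\omega^3\wedge\omega^7-2\omega^4\wedge\omega^6,\\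 d\omega^4&=\omega^6\wedge\omega^8,\quad d\omega^5=\omega^7\wedge\omega^8,\quad d\omega^6=d\omega^7=d\omega^8=0. \end{aligned}$$ Its main invariant is the polynomial in $b$ $$T=-\tilde u_8+(3\tilde u_5-2\tilde u_4)b+(6\tilde u_1-3\tilde u_6-\tilde u_{12})b^2+(\tilde u_7-6\tilde u_2+3\tilde u_9)b^3+(2\tilde u_3-3\tilde u_{10})b^4+\tilde u_{11}b^5 .$$ Assume that at every point $T$ has a root of multiplicity five, and that the coframe is normalized so that $\tilde u_i=0$ for all $i\ne 11$. Write $u=\tilde u_{11}$. (Thus $T=ub^5$ with $u\neq0$, and the equations for $d\omega^1,d\omega^2,d\omega^3$ become $d\omega^1=-\omega^4\wedge\omega^7-\omega^5\wedge\omega^6$, $d\omega^2=-2\omega^5\wedge\omega^7$, $d\omega^3=u\,\omega^2\wedge\omega^7-2\omega^4\wedge\omega^6$.) Then there are unique functions $v_1,v_2,w_1,w_2,w_3,z_1,\dots,z_9$ on $M$ such that $$\begin{aligned} du&=v_1\omega^2+v_2\omega^7, & dv_1&=w_1\omega^2+w_2\omega^7, & dv_2&=w_2\omega^2+2v_1\omega^5+w_3\omega^7,\\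 dw_1&=z_1\omega^2+z_2\omega^7,& dw_2&=z_2\omega^2+2w_1\omega^5+z_3\omega^7,& dw_3&=z_3\omega^2+4w_2\omega^5+z_4\omega^7+2v_1\omega^8,\\ dz_1&=z_5\omega^2+z_6\omega^7,& dz_2&=z_6\omega^2+2z_1\omega^5+z_7\omega^7,& dz_3&=z_7\omega^2+4z_2\omega^5+z_8\omega^7+2w_1\omega^8,\\ &&&&dz_4&=z_8\omega^2+6z_3\omega^5+z_9\omega^7+6w_2\omega^8. \end{aligned}$$ Put $I_1=5v_2^2-4uw_3$, $I_2=v_1$, $I_3=3v_1v_2-2uw_2$, $R=4v_1^2-3uw_1$. Moreover every point of $M$ has a neighbourhood with local coordinates $(y_1,\dots,y_8)$ and a smooth function $h=h(y_2,y_7)$ such that $$\begin{aligned} \omega^1&=dy_8-y_5dy_2+y_3dy_4, & \omega^2&=dy_7-2y_4dy_2, & \omega^3&=dy_6+2y_3dy_5-\tfrac12h_{22}dy_7, & \omega^4&=dy_5-y_1dy_3,\\ \omega^5&=dy_4-y_1dy_2, & \omega^6&=dy_3, & \omega^7&=dy_2, & \omega^8&=dy_1, \end{aligned}$$ and $u=\tfrac12h_{222}\neq0$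 there, where subscripts on $h$ and $u$ denote partial derivatives with respect to $y_2$ and $y_7$. With $D=\partial_2+2y_4\partial_7$ acting on functions of $(y_2,y_7)$, with $y_1,y_4$ treated as parameters, in these coordinates $$\begin{aligned} v_1&=u_7=\tfrac12h_{2227},\\ v_2&=Du=\tfrac12(h_{2222}+2y_4h_{2227}),\\ w_1&=u_{77}=\tfrac12h_{22277},\\ w_2&=(Du)_7=\tfrac12(h_{22227}+2y_4h_{22277}),\\ w_3&=D^2u+2y_1u_7=\tfrac12(h_{22222}+4y_4h_{22227}+4y_4^2h_{22277}+2y_1h_{2227}),\\ z_1&=u_{777}=\tfrac12h_{222777},\\ z_2&=(Du)_{77}=\tfrac12(h_{222277}+2y_4h_{222777}),\\ z_3&=(D^2u+2y_1u_7)_7=\tfrac12(h_{222227}+4y_4h_{222277}+4y_4^2h_{222777}+2y_1h_{22277}),\\ z_4&=D^3u+6y_1(Du)_7=\tfrac12(h_{222222}+6y_4h_{222227}+12y_4^2h_{222277}+6y_1h_{22227}+8y_4^3h_{222777}+12y_1y_4h_{22277}),\\ z_5&=u_{7777}=\tfrac12h_{2227777},\\ z_6&=(Du)_{777}=\tfrac12(h_{2222777}+2y_4h_{2227777}),\\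 z_7&=(D^2u+2y_1u_7)_{77}=\tfrac12(h_{2222277}+4y_4h_{2222777}+4y_4^2h_{2227777}+2y_1h_{222777}),\\ z_8&=(D^3u+6y_1(Du)_7)_7=\tfrac12(h_{2222227}+6y_4h_{2222277}+12y_4^2h_{2222777}+6y_1h_{222277}+8y_4^3h_{2227777}+12y_1y_4h_{222777}),\\ z_9&=D^4u+(12y_1D^2u+12y_1^2u_7)_7=\tfrac12(h_{2222222}+8y_4h_{2222227}+24y_4^2h_{2222277}+12y_1h_{222227}+32y_4^3h_{2222777}\\&\qquad+48y_1y_4h_{222277}+16y_4^4h_{2227777}+48y_1y_4^2h_{222777}+12y_1^2h_{22277}), \end{aligned}$$ and $$\begin{aligned} I_1&=\tfrac14\big(5h_{2222}^2-4h_{222}h_{22222}-8y_1h_{222}h_{2227}+4y_4(5h_{2227}h_{2222}-4h_{222}h_{22227})+4y_4^2(5h_{2227}^2-4h_{222}h_{22277})\big),\\ I_2&=\tfrac12h_{2227},\\ I_3&=\tfrac14\big(3h_{2227}h_{2222}-2h_{222}h_{22227}+2y_4(3h_{2227}^2-2h_{222}h_{22277})\big),\\ R&=\tfrac14(4h_{2227}^2-3h_{222}h_{22277}).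 \end{aligned}$$ -/

import Mathlib

open scoped Manifold ContDiff Polynomial

noncomputable section

namespace MongeEight

/-- The model space. Throughout, objects numbered `1, …, 8` (the coframe forms, the coordinates)
are indexed by `Fin 8` and objects numbered `1, …, 12` (the structural functions) by `Fin 12`,
with the usual numbering: the literal `8 : Fin 8` is the element `0`, and `12 : Fin 12` is `0`. -/
abbrev E8 : Type := EuclideanSpace ℝ (Fin 8)

/-- The coordinate differential `dyᵢ` on the model space. -/
def dy (i : Fin 8) : E8 →L[ℝ] ℝ := EuclideanSpace.proj i

/-- The value `(α ∧ β)(v, w)` for covectors `α`, `β`. -/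
def wedge (α β : E8 →L[ℝ] ℝ) (v w : E8) : ℝ := α v * β w - α w * β v

/-- The value `(dα)_z(v, w)` of the exterior derivative of a 1-form `α` on the model space. -/
def extD (α : E8 → E8 →L[ℝ] ℝ) (z v w : E8) : ℝ :=
  extDeriv (fun x => ContinuousAlternatingMap.ofSubsingleton ℝ E8 ℝ (0 : Fin 1) (α x)) z ![v, w]

section Manifold

variable {M : Type*} [TopologicalSpace M] [ChartedSpace E8 M]

/-- Eight 1-forms on an 8-dimensional manifold. -/
abbrev FormFamily (M : Type*) [TopologicalSpace M] [ChartedSpace E8 M] : Type _ :=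
  Fin 8 → (x : M) → (TangentSpace (𝓡 8) x →L[ℝ] ℝ)

/-- The local representative of the `i`-th form in a chart `e`: its pullback under `e⁻¹`. -/
def inChart (e : OpenPartialHomeomorph M E8) (om : FormFamily M) (i : Fin 8) (z : E8) :
    E8 →L[ℝ] ℝ :=
  (om i (e.symm z)).comp (mfderiv (𝓡 8) (𝓡 8) e.symm z)

end Manifold

/-- The Monge structure equations at the point `z` of the model space, for eight 1-forms `α`
and the values `t` at `z` of the twelve structural functions. -/
def StructureEquations (α : Fin 8 → E8 → E8 →L[ℝ] ℝ) (t : Fin 12 → ℝ) (z : E8) : Prop :=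
  ∀ v w : E8,
    let W : Fin 8 → Fin 8 → ℝ := fun i j => wedge (α i z) (α j z) v w
    extD (α 1) z v w
        = 2 * t 1 * W 1 6 + 2 * t 2 * W 1 7 + t 2 * W 2 6 + t 3 * W 2 7 + t 4 * W 3 6
          + t 1 * W 3 7 - W 4 7 - W 5 6 ∧
    extD (α 2) z v w
        = 2 * t 5 * W 1 6 + 2 * t 6 * W 1 7 + t 6 * W 2 6 + t 7 * W 2 7 + t 8 * W 3 6
          + t 5 * W 3 7 - 2 * W 5 7 ∧
    extD (α 3) z v w
        = 2 * t 9 * W 1 6 + 2 * t 10 * W 1 7 + t 10 * W 2 6 + t 11 * W 2 7 + t 12 * W 3 6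
          + t 9 * W 3 7 - 2 * W 4 6 ∧
    extD (α 4) z v w = W 6 8 ∧
    extD (α 5) z v w = W 7 8 ∧
    extD (α 6) z v w = 0 ∧
    extD (α 7) z v w = 0 ∧
    extD (α 8) z v w = 0

/-- `om` is a smooth coframe on the 8-manifold `M` satisfying the Monge structure equations with
structural functions `t`. The exterior derivatives are computed in the charts of `M`. -/
structure IsMongeCoframe {M : Type*} [TopologicalSpace M] [ChartedSpace E8 M]
    (om : FormFamily M) (t : Fin 12 → M → ℝ) : Prop where
  smooth_form : ∀ i, ∀ e ∈ atlas E8 M, ContDiffOn ℝ ∞ (inChart e om i) e.target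
  smooth_coeff : ∀ i, ContMDiff (𝓡 8) 𝓘(ℝ, ℝ) ∞ (t i)
  linearIndependent : ∀ x, LinearIndependent ℝ (fun i => om i x)
  structure_eq : ∀ e ∈ atlas E8 M, ∀ z ∈ e.target,
    StructureEquations (inChart e om) (fun i => t i (e.symm z)) z

/-- The main invariant: the quintic polynomial `T(b)` built from the structural functions
(here from their values at a point). -/
def mainInvariant (t : Fin 12 → ℝ) : ℝ[X] :=
  - Polynomial.C (t 8)
  + Polynomial.C (3 * t 5 - 2 * t 4) * Polynomial.X
  + Polynomial.C (6 * t 1 - 3 * t 6 - t 12) * Polynomial.X ^ 2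
  + Polynomial.C (t 7 - 6 * t 2 + 3 * t 9) * Polynomial.X ^ 3
  + Polynomial.C (2 * t 3 - 3 * t 10) * Polynomial.X ^ 4
  + Polynomial.C (t 11) * Polynomial.X ^ 5

/-- The derived quantities `v₁, v₂, w₁, w₂, w₃, z₁, …, z₉`. -/
structure DerivedFunctions (M : Type*) where
  (v₁ v₂ w₁ w₂ w₃ z₁ z₂ z₃ z₄ z₅ z₆ z₇ z₈ z₉ : M → ℝ)

/-- `f` is differentiable at `x` with differential `df`. -/
def HasDifferential {M : Type*} [TopologicalSpace M] [ChartedSpace E8 M]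
    (f : M → ℝ) (x : M) (df : TangentSpace (𝓡 8) x →L[ℝ] ℝ) : Prop :=
  HasMFDerivAt (𝓡 8) 𝓘(ℝ, ℝ) f x df

/-- The differential equations that define the derived quantities of the function `u`
relative to the coframe `om`. -/
def IsDerived {M : Type*} [TopologicalSpace M] [ChartedSpace E8 M]
    (om : FormFamily M) (u : M → ℝ) (q : DerivedFunctions M) : Prop :=
  ∀ x : M,
    HasDifferential u x (q.v₁ x • om 2 x + q.v₂ x • om 7 x) ∧
    HasDifferential q.v₁ x (q.w₁ x • om 2 x + q.w₂ x • om 7 x) ∧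
    HasDifferential q.v₂ x (q.w₂ x • om 2 x + (2 * q.v₁ x) • om 5 x + q.w₃ x • om 7 x) ∧
    HasDifferential q.w₁ x (q.z₁ x • om 2 x + q.z₂ x • om 7 x) ∧
    HasDifferential q.w₂ x (q.z₂ x • om 2 x + (2 * q.w₁ x) • om 5 x + q.z₃ x • om 7 x) ∧
    HasDifferential q.w₃ x (q.z₃ x • om 2 x + (4 * q.w₂ x) • om 5 x + q.z₄ x • om 7 x
      + (2 * q.v₁ x) • om 8 x) ∧
    HasDifferential q.z₁ x (q.z₅ x • om 2 x + q.z₆ x • om 7 x) ∧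
    HasDifferential q.z₂ x (q.z₆ x • om 2 x + (2 * q.z₁ x) • om 5 x + q.z₇ x • om 7 x) ∧
    HasDifferential q.z₃ x (q.z₇ x • om 2 x + (4 * q.z₂ x) • om 5 x + q.z₈ x • om 7 x
      + (2 * q.w₁ x) • om 8 x) ∧
    HasDifferential q.z₄ x (q.z₈ x • om 2 x + (6 * q.z₃ x) • om 5 x + q.z₉ x • om 7 x
      + (6 * q.w₂ x) • om 8 x)

/-- The basic invariant `I₁`. -/
def I₁ {M : Type*} (u : M → ℝ) (q : DerivedFunctions M) (x : M) : ℝ :=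
  5 * q.v₂ x ^ 2 - 4 * u x * q.w₃ x

/-- The basic invariant `I₂`. -/
def I₂ {M : Type*} (q : DerivedFunctions M) (x : M) : ℝ := q.v₁ x

/-- The basic invariant `I₃`. -/
def I₃ {M : Type*} (u : M → ℝ) (q : DerivedFunctions M) (x : M) : ℝ :=
  3 * q.v₁ x * q.v₂ x - 2 * u x * q.w₂ x

/-- The basic invariant `R`. -/
def R {M : Type*} (u : M → ℝ) (q : DerivedFunctions M) (x : M) : ℝ :=
  4 * q.v₁ x ^ 2 - 3 * u x * q.w₁ x

/-- `∂f/∂y₂` for a function `f = f(y₂, y₇)`. -/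
def pd2 (f : ℝ → ℝ → ℝ) : ℝ → ℝ → ℝ := fun a b => deriv (fun s => f s b) a

/-- `∂f/∂y₇` for a function `f = f(y₂, y₇)`. -/
def pd7 (f : ℝ → ℝ → ℝ) : ℝ → ℝ → ℝ := fun a b => deriv (fun s => f a s) b

/-- The derivative of `h = h(y₂, y₇)` of order `j` in `y₂` and `k` in `y₇`;
e.g. `pd h 3 1` is `h₂₂₂₇`. -/
def pd (h : ℝ → ℝ → ℝ) (j k : ℕ) : ℝ → ℝ → ℝ := pd7^[k] (pd2^[j] h)

/-- The operator `D = ∂₂ + 2 y₄ ∂₇`, with `y₄` a parameter. -/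
def opD (y₄ : ℝ) (f : ℝ → ℝ → ℝ) : ℝ → ℝ → ℝ := fun a b => pd2 f a b + 2 * y₄ * pd7 f a b

/-- The explicit coframe determined by `h = h(y₂, y₇)`, at the point with coordinates `y`. -/
def IsExplicitCoframe (h : ℝ → ℝ → ℝ) (α : Fin 8 → E8 → E8 →L[ℝ] ℝ) (y : E8) : Prop :=
  α 1 y = dy 8 - y 5 • dy 2 + y 3 • dy 4 ∧
  α 2 y = dy 7 - (2 * y 4) • dy 2 ∧
  α 3 y = dy 6 + (2 * y 3) • dy 5 - (1 / 2 * pd h 2 0 (y 2) (y 7)) • dy 7 ∧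
  α 4 y = dy 5 - y 1 • dy 3 ∧
  α 5 y = dy 4 - y 1 • dy 2 ∧
  α 6 y = dy 3 ∧
  α 7 y = dy 2 ∧
  α 8 y = dy 1

/-- The coordinate expressions of the derived quantities at the point `x` with coordinates `y`,
in terms of the function `h`. -/
def DerivedFormulas {M : Type*} (h : ℝ → ℝ → ℝ) (q : DerivedFunctions M) (x : M) (y : E8) :
    Prop :=
  let H : ℕ → ℕ → ℝ := fun j k => pd h j k (y 2) (y 7)
  q.v₁ x = 1 / 2 * H 3 1 ∧
  q.v₂ x = 1 / 2 * (H 4 0 + 2 * y 4 * H 3 1) ∧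
  q.w₁ x = 1 / 2 * H 3 2 ∧
  q.w₂ x = 1 / 2 * (H 4 1 + 2 * y 4 * H 3 2) ∧
  q.w₃ x = 1 / 2 * (H 5 0 + 4 * y 4 * H 4 1 + 4 * y 4 ^ 2 * H 3 2 + 2 * y 1 * H 3 1) ∧
  q.z₁ x = 1 / 2 * H 3 3 ∧
  q.z₂ x = 1 / 2 * (H 4 2 + 2 * y 4 * H 3 3) ∧
  q.z₃ x = 1 / 2 * (H 5 1 + 4 * y 4 * H 4 2 + 4 * y 4 ^ 2 * H 3 3 + 2 * y 1 * H 3 2) ∧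
  q.z₄ x = 1 / 2 * (H 6 0 + 6 * y 4 * H 5 1 + 12 * y 4 ^ 2 * H 4 2 + 6 * y 1 * H 4 1
      + 8 * y 4 ^ 3 * H 3 3 + 12 * y 1 * y 4 * H 3 2) ∧
  q.z₅ x = 1 / 2 * H 3 4 ∧
  q.z₆ x = 1 / 2 * (H 4 3 + 2 * y 4 * H 3 4) ∧
  q.z₇ x = 1 / 2 * (H 5 2 + 4 * y 4 * H 4 3 + 4 * y 4 ^ 2 * H 3 4 + 2 * y 1 * H 3 3) ∧
  q.z₈ x = 1 / 2 * (H 6 1 + 6 * y 4 * H 5 2 + 12 * y 4 ^ 2 * H 4 3 + 6 * y 1 * H 4 2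
      + 8 * y 4 ^ 3 * H 3 4 + 12 * y 1 * y 4 * H 3 3) ∧
  q.z₉ x = 1 / 2 * (H 7 0 + 8 * y 4 * H 6 1 + 24 * y 4 ^ 2 * H 5 2 + 12 * y 1 * H 5 1
      + 32 * y 4 ^ 3 * H 4 3 + 48 * y 1 * y 4 * H 4 2 + 16 * y 4 ^ 4 * H 3 4
      + 48 * y 1 * y 4 ^ 2 * H 3 3 + 12 * y 1 ^ 2 * H 3 2)

/-- The coordinate expressions of the derived quantities at the point `x` with coordinates `y`,
in terms of `u = u(y₂, y₇)` and the operator `D`. -/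
def DerivedFormulasD {M : Type*} (u : ℝ → ℝ → ℝ) (q : DerivedFunctions M) (x : M) (y : E8) :
    Prop :=
  let D : (ℝ → ℝ → ℝ) → (ℝ → ℝ → ℝ) := opD (y 4)
  q.v₁ x = pd7 u (y 2) (y 7) ∧
  q.v₂ x = D u (y 2) (y 7) ∧
  q.w₁ x = pd7^[2] u (y 2) (y 7) ∧
  q.w₂ x = pd7 (D u) (y 2) (y 7) ∧
  q.w₃ x = D^[2] u (y 2) (y 7) + 2 * y 1 * pd7 u (y 2) (y 7) ∧
  q.z₁ x = pd7^[3] u (y 2) (y 7) ∧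
  q.z₂ x = pd7^[2] (D u) (y 2) (y 7) ∧
  q.z₃ x = pd7 (fun a b => D^[2] u a b + 2 * y 1 * pd7 u a b) (y 2) (y 7) ∧
  q.z₄ x = D^[3] u (y 2) (y 7) + 6 * y 1 * pd7 (D u) (y 2) (y 7) ∧
  q.z₅ x = pd7^[4] u (y 2) (y 7) ∧
  q.z₆ x = pd7^[3] (D u) (y 2) (y 7) ∧
  q.z₇ x = pd7^[2] (fun a b => D^[2] u a b + 2 * y 1 * pd7 u a b) (y 2) (y 7) ∧
  q.z₈ x = pd7 (fun a b => D^[3] u a b + 6 * y 1 * pd7 (D u) a b) (y 2) (y 7) ∧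
  q.z₉ x = D^[4] u (y 2) (y 7)
      + pd7 (fun a b => 12 * y 1 * D^[2] u a b + 12 * y 1 ^ 2 * pd7 u a b) (y 2) (y 7)

/-- The coordinate expressions of the basic invariants. -/
def InvariantFormulas {M : Type*} (h : ℝ → ℝ → ℝ) (u : M → ℝ) (q : DerivedFunctions M)
    (x : M) (y : E8) : Prop :=
  let H : ℕ → ℕ → ℝ := fun j k => pd h j k (y 2) (y 7)
  I₁ u q x = 1 / 4 * (5 * H 4 0 ^ 2 - 4 * H 3 0 * H 5 0 - 8 * y 1 * H 3 0 * H 3 1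
      + 4 * y 4 * (5 * H 3 1 * H 4 0 - 4 * H 3 0 * H 4 1)
      + 4 * y 4 ^ 2 * (5 * H 3 1 ^ 2 - 4 * H 3 0 * H 3 2)) ∧
  I₂ q x = 1 / 2 * H 3 1 ∧
  I₃ u q x = 1 / 4 * (3 * H 3 1 * H 4 0 - 2 * H 3 0 * H 4 1
      + 2 * y 4 * (3 * H 3 1 ^ 2 - 2 * H 3 0 * H 3 2)) ∧
  R u q x = 1 / 4 * (4 * H 3 1 ^ 2 - 3 * H 3 0 * H 3 2)

end MongeEight

end

open Set Filter Topology

namespace MongeEight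

/-! ### Exterior derivatives of 1-forms and the Poincaré lemma -/

section Forms

variable {β γ : E8 → E8 →L[ℝ] ℝ} {f : E8 → ℝ} {z : E8}

/-! The normalized structure equations can be integrated one at a time on a ball. The forms `ω⁸`,
`ω⁷`, `ω⁶` are closed, with potentials `y₁`, `y₂`, `y₃`; after that `ω⁴ + y₁ω⁶`, `ω⁵ + y₁ω⁷`, `ω² +
2y₄ω⁷` and `ω¹ + y₅ω⁷ - y₃dy₄` turn out closed, which yields `y₅`, `y₄`, `y₇`, `y₈`. The remaining
form satisfies `d(ω³ - 2y₃dy₅) = u dy₇ ∧ dy₂`. Applying `d² = 0` to it gives `du ∧ dy₇ ∧ dy₂ = 0`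
(`cyclic_sum_eq_zero`), so `u` is locally a function of `y₂`, `y₇`
(`exists_eventuallyEq_of_fderiv_eq_zero`). Integrating `2u` three times in `y₂` gives `h`, and `ω³ -
2y₃dy₅ + ½h₂₂dy₇` is closed with potential `y₆`. The eight differentials are triangular in the
coframe, hence the `yᵢ` are coordinates. This is `exists_normal_coordinates`.

In these coordinates `dy₇ = ω² + 2y₄ω⁷`, `dy₄ = ω⁵ + y₁ω⁷`, `dy₂ = ω⁷` and `dy₁ = ω⁸`. On functions
of `y₁, y₂, y₄, y₇` the coefficients of `ω²`, `ω⁵`, `ω⁷`, `ω⁸` in the differential are therefore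
`∂₇`, `∂₄`, `D + y₁∂₄`, `∂₁`. Every derived quantity comes from `u` by iterating `∂₇` and `D +
y₁∂₄`, and the formulas solve the system locally (`isDerivedAt_of_formulas`).

Since the coframe is independent, each equation determines its `ω²` and `ω⁷` coefficients, so the
system has at most one solution on any open set (`eval_eq_eval`). Uniqueness glues the local
solutions into a global one and forces that one to obey the coordinate formulas in every normal
chart. -/

theorem extD_eq (hβ : DifferentiableAt ℝ β z) (v w : E8) :
    extD β z v w = fderiv ℝ β z v w - fderiv ℝ β z w v := by
  let L : (E8 →L[ℝ] ℝ) →L[ℝ] (E8 [⋀^Fin 1]→L[ℝ] ℝ) :=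
    (ContinuousAlternatingMap.ofSubsingletonLIE (𝕜 := ℝ) (E := E8) (F := ℝ) (0 : Fin 1)).toContinuousLinearEquiv
  have h : HasFDerivAt (fun x => ContinuousAlternatingMap.ofSubsingleton ℝ E8 ℝ (0 : Fin 1) (β x))
      (L.comp (fderiv ℝ β z)) z := L.hasFDerivAt.comp z hβ.hasFDerivAt
  unfold extD extDeriv
  rw [h.fderiv, ContinuousAlternatingMap.alternatizeUncurryFin_apply]
  simp [Fin.sum_univ_two, L, Fin.removeNth]
  ring

theorem extD_add (hβ : DifferentiableAt ℝ β z) (hγ : DifferentiableAt ℝ γ z) (v w : E8) :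
    extD (fun x => β x + γ x) z v w = extD β z v w + extD γ z v w := by
  rw [extD_eq (hβ.fun_add hγ), extD_eq hβ, extD_eq hγ, fderiv_fun_add hβ hγ]
  simp only [add_apply]
  ring

theorem extD_smul (hf : DifferentiableAt ℝ f z) (hβ : DifferentiableAt ℝ β z) (v w : E8) :
    extD (fun x => f x • β x) z v w = f z * extD β z v w + wedge (fderiv ℝ f z) (β z) v w := by
  rw [extD_eq (hf.fun_smul hβ), extD_eq hβ, fderiv_fun_smul hf hβ]
  simp only [wedge, add_apply, smul_apply, ContinuousLinearMap.smulRight_apply, smul_eq_mul]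
  ring

/-- A form which is the differential of a function is closed. -/
theorem extD_of_hasFDerivAt {s : Set E8} (hs : IsOpen s) (hz : z ∈ s)
    (hβ : ContDiffOn ℝ ∞ β s) (hf : ∀ x ∈ s, HasFDerivAt f (β x) x) (v w : E8) :
    extD β z v w = 0 := by
  have hd : DifferentiableAt ℝ β z :=
    (hβ.contDiffAt (hs.mem_nhds hz)).differentiableAt (by simp)
  rw [extD_eq hd, sub_eq_zero]
  exact second_derivative_symmetric_of_eventually
    (eventually_of_mem (hs.mem_nhds hz) hf) hd.hasFDerivAt v w

/-- The Poincaré lemma for smooth 1-forms on open convex subsets of the model space. -/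
theorem exists_potential {s : Set E8} (hs : IsOpen s) (hc : Convex ℝ s)
    (hβ : ContDiffOn ℝ ∞ β s) (hcl : ∀ x ∈ s, ∀ v w, extD β x v w = 0) :
    ∃ f : E8 → ℝ, ContDiffOn ℝ ∞ f s ∧ ∀ x ∈ s, HasFDerivAt f (β x) x := by
  have hd : DifferentiableOn ℝ β s := hβ.differentiableOn (by simp)
  obtain ⟨f, hf⟩ := hc.exists_forall_hasFDerivAt_of_fderiv_symmetric hs hd fun a ha v w => by
    have := hcl a ha v w
    rwa [extD_eq (hd.differentiableAt (hs.mem_nhds ha)), sub_eq_zero] at this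
  refine ⟨f, (contDiffOn_infty_iff_fderiv_of_isOpen hs).2
    ⟨fun x hx => (hf x hx).differentiableAt.differentiableWithinAt, ?_⟩, hf⟩
  exact hβ.congr fun x hx => (hf x hx).fderiv

/-- If `dη = u α ∧ γ` with `α`, `γ` closed then `du ∧ α ∧ γ = 0`. -/
theorem cyclic_sum_eq_zero {s : Set E8} (hs : IsOpen s) (hz : z ∈ s)
    {η : E8 → E8 →L[ℝ] ℝ} (hη : ContDiffOn ℝ ∞ η s) (hβ : DifferentiableAt ℝ β z)
    (hγ : DifferentiableAt ℝ γ z) (hf : DifferentiableAt ℝ f z)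
    (hβc : ∀ v w, extD β z v w = 0) (hγc : ∀ v w, extD γ z v w = 0)
    (hd : ∀ x ∈ s, ∀ v w, extD η x v w = f x * wedge (β x) (γ x) v w) (x v w : E8) :
    fderiv ℝ f z x * wedge (β z) (γ z) v w + fderiv ℝ f z v * wedge (β z) (γ z) w x
      + fderiv ℝ f z w * wedge (β z) (γ z) x v = 0 := by
  have hη1 : ∀ x ∈ s, DifferentiableAt ℝ η x := fun x hx =>
    (hη.contDiffAt (hs.mem_nhds hx)).differentiableAt (by simp)
  have hη2 : ContDiffAt ℝ ∞ η z := hη.contDiffAt (hs.mem_nhds hz)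
  have hη3 : DifferentiableAt ℝ (fderiv ℝ η) z :=
    (hη2.fderiv_right (m := ∞) (by simp)).differentiableAt (by simp)
  have hsymm : ∀ a b, fderiv ℝ (fderiv ℝ η) z a b = fderiv ℝ (fderiv ℝ η) z b a :=
    second_derivative_symmetric_of_eventually
      (eventually_of_mem (hs.mem_nhds hz) fun x hx => (hη1 x hx).hasFDerivAt) hη3.hasFDerivAt
  -- The identity `dη = f β ∧ γ`, evaluated on `(b, c)` and differentiated in the direction `a`. In
  -- the cyclic sum the second derivatives of `η` cancel by symmetry, and those of `β`, `γ` by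
  -- closedness.
  have key : ∀ a b c : E8,
      fderiv ℝ (fderiv ℝ η) z a b c - fderiv ℝ (fderiv ℝ η) z a c b
      = fderiv ℝ f z a * wedge (β z) (γ z) b c
        + f z * (fderiv ℝ β z a b * γ z c + β z b * fderiv ℝ γ z a c
          - (fderiv ℝ β z a c * γ z b + β z c * fderiv ℝ γ z a b)) := by
    intro a b c
    have e : (fun x => fderiv ℝ η x b c - fderiv ℝ η x c b)
        =ᶠ[𝓝 z] fun x => f x * (β x b * γ x c - β x c * γ x b) :=
      eventually_of_mem (hs.mem_nhds hz) fun x hx => by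
        have := hd x hx b c
        rw [extD_eq (hη1 x hx)] at this
        simp only [this, wedge]
    have ev : ∀ {g : E8 → E8 →L[ℝ] ℝ} (b : E8), DifferentiableAt ℝ g z →
        HasFDerivAt (fun x => g x b) ((fderiv ℝ g z).flip b) z := fun {g} b hg => by
      simpa using hg.hasFDerivAt.clm_apply (hasFDerivAt_const b z)
    have ev2 : ∀ b c : E8, HasFDerivAt (fun x => fderiv ℝ η x b c)
        (((fderiv ℝ (fderiv ℝ η) z).flip b).flip c) z := fun b c => by
      have h1 : HasFDerivAt (fun x => fderiv ℝ η x b) ((fderiv ℝ (fderiv ℝ η) z).flip b) z := by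
        simpa using hη3.hasFDerivAt.clm_apply (hasFDerivAt_const b z)
      simpa using h1.clm_apply (hasFDerivAt_const c z)
    have h1 := ((ev2 b c).sub (ev2 c b)).congr_of_eventuallyEq e.symm
    have h2 := hf.hasFDerivAt.mul (((ev b hβ).mul (ev c hγ)).sub ((ev c hβ).mul (ev b hγ)))
    have h3 := congrArg (fun L : E8 →L[ℝ] ℝ => L a) (h1.unique h2)
    simp only [sub_apply, add_apply, smul_apply, ContinuousLinearMap.flip_apply, smul_eq_mul,
      Pi.mul_apply, Pi.sub_apply] at h3
    rw [h3, wedge]; ring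
  have k1 := key x v w
  have k2 := key v w x
  have k3 := key w x v
  rw [hsymm x v] at k1
  rw [hsymm v w] at k2
  rw [hsymm w x] at k3
  have cβ : ∀ v w, fderiv ℝ β z v w = fderiv ℝ β z w v := fun v w => by
    have := hβc v w; rwa [extD_eq hβ, sub_eq_zero] at this
  have cγ : ∀ v w, fderiv ℝ γ z v w = fderiv ℝ γ z w v := fun v w => by
    have := hγc v w; rwa [extD_eq hγ, sub_eq_zero] at this
  rw [cβ x v, cβ x w, cγ x w, cγ x v] at k1
  rw [cβ v w, cγ v w] at k2
  linear_combination -k1 - k2 - k3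

end Forms

/-! ### Linear algebra of eight covectors -/

/-- Eight linearly independent covectors take arbitrary values simultaneously. -/
theorem bijective_of_linearIndependent {L : Fin 8 → E8 →L[ℝ] ℝ} (hL : LinearIndependent ℝ L) :
    Function.Bijective (ContinuousLinearMap.pi L : E8 →L[ℝ] (Fin 8 → ℝ)) := by
  have hinj : Function.Injective (ContinuousLinearMap.pi L : E8 →L[ℝ] (Fin 8 → ℝ)) := by
    rw [injective_iff_map_eq_zero]
    intro v hv
    have hv' : ∀ i, L i v = 0 := fun i => congrFun hv i
    have hL' : LinearIndependent ℝ (fun i => (L i : E8 →ₗ[ℝ] ℝ)) :=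
      hL.map' (ContinuousLinearMap.coeLM ℝ) (LinearMap.ker_eq_bot.2 ContinuousLinearMap.coe_injective)
    have hspan := hL'.span_eq_top_of_card_eq_finrank' (by simp [Subspace.dual_finrank_eq])
    -- Eight independent covectors span the dual, so a vector killed by all of them is killed by
    -- every functional.
    refine (Module.forall_dual_apply_eq_zero_iff ℝ v).1 fun φ => ?_
    have hφ : φ ∈ Submodule.span ℝ (Set.range fun i => (L i : E8 →ₗ[ℝ] ℝ)) := hspan ▸ trivial
    induction hφ using Submodule.span_induction with
    | mem x hx => obtain ⟨i, rfl⟩ := hx; exact hv' i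
    | zero => rfl
    | add x y _ _ hx hy => simp [hx, hy]
    | smul a x _ hx => simp [hx]
  refine ⟨hinj, ?_⟩
  exact ((ContinuousLinearMap.pi L : E8 →L[ℝ] (Fin 8 → ℝ)) : E8 →ₗ[ℝ] (Fin 8 → ℝ)).injective_iff_surjective_of_finrank_eq_finrank
    (by simp) |>.1 hinj

theorem exists_apply_eq {L : Fin 8 → E8 →L[ℝ] ℝ} (hL : LinearIndependent ℝ L) (c : Fin 8 → ℝ) :
    ∃ v, ∀ i, L i v = c i := by
  obtain ⟨v, hv⟩ := (bijective_of_linearIndependent hL).2 c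
  exact ⟨v, fun i => congrFun hv i⟩

theorem eq_zero_of_apply_eq_zero {L : Fin 8 → E8 →L[ℝ] ℝ} (hL : LinearIndependent ℝ L) {v : E8}
    (hv : ∀ i, L i v = 0) : v = 0 :=
  (bijective_of_linearIndependent hL).1 (by ext i; simp [hv i])

/-! ### Primitives and smooth extension in two variables -/

open MeasureTheory in
/-- The primitive of a smooth function in one variable depends smoothly on all variables. -/
theorem contDiff_primitive {f : ℝ → ℝ → ℝ} (hf : ContDiff ℝ ∞ (Function.uncurry f)) :
    ContDiff ℝ ∞ (Function.uncurry fun a b => ∫ s in (0 : ℝ)..a, f s b) := by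
  let χ : ContDiffBump (0 : ℝ) := ⟨1, 2, by norm_num, by norm_num⟩
  -- After rescaling, the primitive is the integral over `0 < t ≤ 1` of `a f(ta, b)`, which is the
  -- convolution at `0` of an indicator function with `g (a, b)`. The sign in `-x` undoes the
  -- reflection in the convolution; the cutoff equals `1` where it matters and supplies the compact
  -- support needed for smooth dependence on parameters.
  let g : ℝ × ℝ → ℝ → ℝ := fun p x => χ x * (p.1 * f (-x * p.1) p.2)
  have hg : ContDiff ℝ ∞ (Function.uncurry g) := by
    have h1 : ContDiff ℝ ∞ fun q : (ℝ × ℝ) × ℝ => χ q.2 := χ.contDiff.comp contDiff_snd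
    have h2 : ContDiff ℝ ∞ fun q : (ℝ × ℝ) × ℝ => f (-q.2 * q.1.1) q.1.2 :=
      hf.comp (g := Function.uncurry f)
        (f := fun q : (ℝ × ℝ) × ℝ => (-q.2 * q.1.1, q.1.2)) (by fun_prop)
    exact h1.mul ((contDiff_fst.comp contDiff_fst).mul h2)
  have hind : LocallyIntegrable (indicator (Ioc (0 : ℝ) 1) (fun _ => (1 : ℝ))) volume :=
    (integrable_indicator_iff measurableSet_Ioc |>.2 (by simp)).locallyIntegrable
  have hc := contDiffOn_convolution_right_with_param (n := ⊤) (μ := volume)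
    (ContinuousLinearMap.mul ℝ ℝ) (s := (univ : Set (ℝ × ℝ))) (k := Metric.closedBall (0 : ℝ) 2)
    (g := g) isOpen_univ (isCompact_closedBall _ _) (fun p x _ hx => by
      have : χ x = 0 := χ.zero_of_le_dist (by
        simpa [χ] using (not_le.1 (mt Metric.mem_closedBall.2 hx)).le)
      simp [g, this]) hind hg.contDiffOn
  rw [univ_prod_univ, contDiffOn_univ] at hc
  have hc' := hc.comp (f := fun p : ℝ × ℝ => (p, (0 : ℝ))) (by fun_prop)
  convert hc' using 1
  ext ⟨a, b⟩
  simp only [Function.uncurry, Function.comp, convolution, ContinuousLinearMap.mul_apply', zero_sub,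
    g, neg_neg]
  rw [show (fun t : ℝ => indicator (Ioc (0 : ℝ) 1) (fun _ => (1 : ℝ)) t
        * (χ (-t) * (a * f (t * a) b)))
      = indicator (Ioc (0 : ℝ) 1) (fun t => a * f (t * a) b) from ?_,
    integral_indicator measurableSet_Ioc, ← intervalIntegral.integral_of_le zero_le_one,
    intervalIntegral.integral_const_mul, ← smul_eq_mul,
    intervalIntegral.smul_integral_comp_mul_right (fun s => f s b)]
  · simp
  · ext t
    by_cases ht : t ∈ Ioc (0 : ℝ) 1
    · have : χ (-t) = 1 := χ.one_of_mem_closedBall (by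
        simpa [χ, abs_of_pos ht.1] using ht.2)
      simp [ht, this]
    · simp [ht]

theorem pd2_primitive {f : ℝ → ℝ → ℝ} (hf : ContDiff ℝ ∞ (Function.uncurry f)) :
    pd2 (fun a b => ∫ s in (0 : ℝ)..a, f s b) = f := by
  ext a b
  have hc : Continuous fun s => f s b :=
    hf.continuous.comp (f := fun s : ℝ => (s, b)) (by fun_prop)
  exact (intervalIntegral.integral_hasDerivAt_right (hc.intervalIntegrable _ _)
    (hc.stronglyMeasurableAtFilter _ _) hc.continuousAt).deriv

theorem exists_pd_three_zero {f : ℝ → ℝ → ℝ} (hf : ContDiff ℝ ∞ (Function.uncurry f)) :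
    ∃ h : ℝ → ℝ → ℝ, ContDiff ℝ ∞ (Function.uncurry h) ∧ pd h 3 0 = f := by
  have h1 := contDiff_primitive hf
  have h2 := contDiff_primitive h1
  refine ⟨_, contDiff_primitive h2, ?_⟩
  change pd2 (pd2 (pd2 _)) = f
  rw [pd2_primitive h2, pd2_primitive h1, pd2_primitive hf]

/-- A function smooth near a point agrees near this point with a globally smooth function. -/
theorem exists_contDiff_eventuallyEq {U : ℝ × ℝ → ℝ} {s : Set (ℝ × ℝ)} {c : ℝ × ℝ} (hs : s ∈ 𝓝 c)
    (hU : ContDiffOn ℝ ∞ U s) : ∃ V : ℝ × ℝ → ℝ, ContDiff ℝ ∞ V ∧ V =ᶠ[𝓝 c] U := by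
  obtain ⟨r, hr, hrs⟩ := Metric.nhds_basis_ball.mem_iff.1 hs
  let χ : ContDiffBump c := ⟨r / 4, r / 2, by linarith, by linarith⟩
  refine ⟨fun p => χ p * U p, ?_, ?_⟩
  · rw [contDiff_iff_contDiffAt]
    intro p
    by_cases hp : p ∈ Metric.ball c r
    · exact χ.contDiff.contDiffAt.mul ((hU.mono hrs).contDiffAt (Metric.isOpen_ball.mem_nhds hp))
    · have : (fun p => χ p * U p) =ᶠ[𝓝 p] fun _ => 0 := by
        have hp' : p ∉ tsupport χ := by
          rw [χ.tsupport_eq]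
          simp only [Metric.mem_closedBall, Metric.mem_ball, not_le, not_lt, χ] at hp ⊢
          linarith
        filter_upwards [notMem_tsupport_iff_eventuallyEq.1 hp'] with q hq
        simp [hq]
      exact contDiffAt_const.congr_of_eventuallyEq this
  · filter_upwards [χ.eventuallyEq_one] with p hp
    simp [hp]

/-! ### Local coordinates and functions of two of them -/

section Coordinates

variable {O : Set E8} {z₀ : E8} {Y : Fin 8 → E8 → ℝ} {L : Fin 8 → E8 → E8 →L[ℝ] ℝ}

/-- Eight smooth functions with independent differentials are local coordinates. -/
theorem exists_coordinates (hO : IsOpen O) (hz₀ : z₀ ∈ O)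
    (hY : ∀ i, ContDiffOn ℝ ∞ (Y i) O) (hL : ∀ i, ∀ z ∈ O, HasFDerivAt (Y i) (L i z) z)
    (hli : LinearIndependent ℝ fun i => L i z₀) :
    ∃ Φ : OpenPartialHomeomorph E8 E8, z₀ ∈ Φ.source ∧ Φ.source ⊆ O ∧ (∀ z i, Φ z i = Y i z) ∧
      ContDiffOn ℝ ∞ Φ Φ.source ∧ ContDiffOn ℝ ∞ Φ.symm Φ.target := by
  let F : E8 → E8 := fun z => WithLp.toLp 2 fun i => Y i z
  let T : E8 ≃L[ℝ] (Fin 8 → ℝ) := EuclideanSpace.equiv (Fin 8) ℝ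
  have hF : ContDiffOn ℝ ∞ F O := contDiffOn_euclidean.2 hY
  have hLc : ContinuousOn (fun z i => L i z) O := continuousOn_pi.2 fun i =>
    (((contDiffOn_infty_iff_fderiv_of_isOpen hO).1 (hY i)).2.continuousOn).congr
      fun z hz => ((hL i z hz).fderiv).symm
  -- Smoothness of the inverse at a point of the target needs an invertible derivative at its
  -- preimage, so the source is cut down to the open set where the differentials stay independent.
  let O' : Set E8 := O ∩ (fun z i => L i z) ⁻¹' {f | LinearIndependent ℝ f}
  have hO' : IsOpen O' := hLc.isOpen_inter_preimage hO isOpen_setOfPred_linearIndependent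
  have hder : ∀ z ∈ O', ∃ F' : E8 ≃L[ℝ] E8, HasFDerivAt F (F' : E8 →L[ℝ] E8) z := by
    intro z hz
    let e : E8 ≃L[ℝ] (Fin 8 → ℝ) :=
      (LinearEquiv.ofBijective (ContinuousLinearMap.pi fun i => L i z : E8 →L[ℝ] (Fin 8 → ℝ)).toLinearMap
        (bijective_of_linearIndependent hz.2)).toContinuousLinearEquiv
    refine ⟨e.trans T.symm, ?_⟩
    rw [← hasFDerivWithinAt_univ, hasFDerivWithinAt_euclidean]
    exact fun i => (hL i z hz.1).hasFDerivWithinAt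
  obtain ⟨F₀, hF₀⟩ := hder z₀ ⟨hz₀, hli⟩
  have hFz₀ : ContDiffAt ℝ ∞ F z₀ := hF.contDiffAt (hO.mem_nhds hz₀)
  let Φ := (hFz₀.toOpenPartialHomeomorph F hF₀ (by simp)).restrOpen O' hO'
  have hsrc : Φ.source ⊆ O' := by
    rw [OpenPartialHomeomorph.restrOpen_source]; exact inter_subset_right
  refine ⟨Φ, ⟨hFz₀.mem_toOpenPartialHomeomorph_source hF₀ (by simp), hz₀, hli⟩,
    hsrc.trans inter_subset_left, fun z i => rfl, hF.mono (hsrc.trans inter_subset_left), ?_⟩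
  intro ζ hζ
  have hζ' := hsrc (Φ.map_target hζ)
  obtain ⟨F', hF'⟩ := hder _ hζ'
  exact (Φ.contDiffAt_symm hζ hF' (hF.contDiffAt (hO.mem_nhds hζ'.1))).contDiffWithinAt

theorem comp_fderiv_symm {Φ : OpenPartialHomeomorph E8 E8} (hsymm : ContDiffOn ℝ ∞ Φ.symm Φ.target)
    {i : Fin 8} {f : E8 → ℝ} {f' : E8 →L[ℝ] ℝ} {ζ : E8} (hf : ∀ z, Φ z i = f z)
    (hζ : ζ ∈ Φ.target) (hf' : HasFDerivAt f f' (Φ.symm ζ)) :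
    f'.comp (fderiv ℝ Φ.symm ζ) = dy i := by
  have h1 : HasFDerivAt Φ.symm (fderiv ℝ Φ.symm ζ) ζ :=
    ((hsymm.contDiffAt (Φ.open_target.mem_nhds hζ)).differentiableAt (by simp)).hasFDerivAt
  have h2 : HasFDerivAt (fun x : E8 => x i) (dy i) ζ := (dy i).hasFDerivAt
  refine (hf'.comp ζ h1).unique (h2.congr_of_eventuallyEq ?_)
  filter_upwards [Φ.open_target.mem_nhds hζ] with x hx
  simp [← hf, Φ.right_inv hx]

/-- A function whose differential is a combination of `dY₂` and `dY₇` depends on `Y₂`, `Y₇` only. -/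
theorem exists_eventuallyEq_of_fderiv_eq_zero {Φ : OpenPartialHomeomorph E8 E8}
    (hz₀ : z₀ ∈ Φ.source) (hΦY : ∀ z i, Φ z i = Y i z)
    (hsymm : ContDiffOn ℝ ∞ Φ.symm Φ.target)
    (hL2 : ∀ z ∈ Φ.source, HasFDerivAt (Y 2) (L 2 z) z)
    (hL7 : ∀ z ∈ Φ.source, HasFDerivAt (Y 7) (L 7 z) z)
    {u : E8 → ℝ} (hu : ContDiffOn ℝ ∞ u Φ.source)
    (hker : ∀ z ∈ Φ.source, ∀ x, L 2 z x = 0 → L 7 z x = 0 → fderiv ℝ u z x = 0) :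
    ∃ V : ℝ → ℝ → ℝ, ContDiff ℝ ∞ (Function.uncurry V) ∧ ∀ᶠ z in 𝓝 z₀, u z = V (Y 2 z) (Y 7 z) := by
  obtain ⟨r, hr, hrt⟩ := Metric.nhds_basis_ball.mem_iff.1
    (Φ.open_target.mem_nhds (Φ.map_source hz₀))
  set ζ₀ := Φ z₀
  let w : E8 → ℝ := u ∘ Φ.symm
  have hw : ContDiffOn ℝ ∞ w Φ.target := hu.comp hsymm Φ.mapsTo_symm
  -- The slice through `ζ₀` along the coordinates `2` and `7`. Moving the other coordinates to those
  -- of `ζ₀` only decreases the distance to `ζ₀`, so the ball is preserved.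
  let ι : ℝ × ℝ → E8 := fun p =>
    WithLp.toLp 2 fun i => if i = 2 then p.1 else if i = 7 then p.2 else ζ₀ i
  have hι : ContDiff ℝ ∞ ι := contDiff_euclidean.2 fun i => by
    by_cases h2 : i = 2
    · simpa [ι, h2] using contDiff_fst
    · by_cases h7 : i = 7
      · simpa [ι, h7] using contDiff_snd
      · simpa [ι, h2, h7] using contDiff_const
  have hι₀ : ι (ζ₀ 2, ζ₀ 7) = ζ₀ := by
    ext i
    by_cases h2 : i = 2
    · simp [ι, h2]
    · by_cases h7 : i = 7 <;> simp [ι, h2, h7]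
  have hιr : ∀ ζ ∈ Metric.ball ζ₀ r, ι (ζ 2, ζ 7) ∈ Metric.ball ζ₀ r := by
    intro ζ hζ
    refine lt_of_le_of_lt ?_ (Metric.mem_ball.1 hζ)
    rw [EuclideanSpace.dist_eq, EuclideanSpace.dist_eq]
    refine Real.sqrt_le_sqrt (Finset.sum_le_sum fun i _ => ?_)
    by_cases h2 : i = 2
    · simp [ι, h2]
    · by_cases h7 : i = 7
      · simp [ι, h7]
      · simp [ι, h2, h7]
  have hconst : ∀ ζ ∈ Metric.ball ζ₀ r, w ζ = w (ι (ζ 2, ζ 7)) := by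
    intro ζ hζ
    set d : E8 := ζ - ι (ζ 2, ζ 7)
    have hd2 : d 2 = 0 := by simp [d, ι]
    have hd7 : d 7 = 0 := by simp [d, ι]
    have hseg : ∀ t ∈ Icc (0 : ℝ) 1, ι (ζ 2, ζ 7) + t • d ∈ Metric.ball ζ₀ r := fun t ht =>
      (convex_ball ζ₀ r).add_smul_sub_mem (hιr ζ hζ) hζ ht
    have hder : ∀ t ∈ Icc (0 : ℝ) 1,
        HasDerivAt (fun t : ℝ => w (ι (ζ 2, ζ 7) + t • d)) 0 t := by
      intro t ht
      set ξ := ι (ζ 2, ζ 7) + t • d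
      have hξ := hrt (hseg t ht)
      have h1 : HasFDerivAt Φ.symm (fderiv ℝ Φ.symm ξ) ξ :=
        ((hsymm.contDiffAt (Φ.open_target.mem_nhds hξ)).differentiableAt (by simp)).hasFDerivAt
      have hs := Φ.map_target hξ
      have h2 : HasFDerivAt u (fderiv ℝ u (Φ.symm ξ)) (Φ.symm ξ) :=
        ((hu.contDiffAt (Φ.open_source.mem_nhds hs)).differentiableAt (by simp)).hasFDerivAt
      have h3 : HasDerivAt (fun t : ℝ => ι (ζ 2, ζ 7) + t • d) d t := by
        simpa using ((hasDerivAt_id t).smul_const d).const_add (ι (ζ 2, ζ 7))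
      have h4 := (h2.comp ξ h1).comp_hasDerivAt t h3
      -- The segment direction `d` has no components along `2` and `7`, so its image under the
      -- derivative of `Φ.symm` is annihilated by `dY₂` and `dY₇`.
      suffices h0 : fderiv ℝ u (Φ.symm ξ) (fderiv ℝ Φ.symm ξ d) = 0 by
        rw [← h0]; exact h4
      refine hker _ hs _ ?_ ?_
      · have := comp_fderiv_symm hsymm (fun z => hΦY z 2) hξ (hL2 _ hs)
        exact (congrArg (fun A : E8 →L[ℝ] ℝ => A d) this).trans hd2
      · have := comp_fderiv_symm hsymm (fun z => hΦY z 7) hξ (hL7 _ hs)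
        exact (congrArg (fun A : E8 →L[ℝ] ℝ => A d) this).trans hd7
    obtain ⟨c, -, hc⟩ := exists_hasDerivAt_eq_slope _ _ (zero_lt_one' ℝ)
      (fun t ht => (hder t ht).continuousAt.continuousWithinAt)
      (fun t ht => hder t (Ioo_subset_Icc_self ht))
    simp only [one_smul, zero_smul, add_zero, sub_zero, div_one, d, add_sub_cancel] at hc
    linarith
  have hc : ContinuousAt ι (ζ₀ 2, ζ₀ 7) := hι.continuous.continuousAt
  have hnhds : ι ⁻¹' Metric.ball ζ₀ r ∈ 𝓝 (ζ₀ 2, ζ₀ 7) :=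
    hc (by rw [hι₀]; exact Metric.ball_mem_nhds _ hr)
  -- The restriction to the slice is smooth only near the centre; a cutoff makes it globally smooth
  -- without changing its germ.
  obtain ⟨V, hV, hVe⟩ := exists_contDiff_eventuallyEq (U := w ∘ ι) hnhds
    (hw.comp hι.contDiffOn fun p hp => hrt hp)
  refine ⟨Function.curry V, by simpa using hV, ?_⟩
  have hΦc : ContinuousAt Φ z₀ := Φ.continuousAt hz₀
  have hpair : Tendsto (fun z => (Φ z 2, Φ z 7)) (𝓝 z₀) (𝓝 (ζ₀ 2, ζ₀ 7)) := by
    have : ContinuousAt (fun x : E8 => (x 2, x 7)) ζ₀ := by fun_prop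
    exact this.comp hΦc
  filter_upwards [hpair.eventually hVe, hΦc (Metric.ball_mem_nhds ζ₀ hr),
    Φ.open_source.mem_nhds hz₀] with z h1 h2 h3
  rw [← hΦY, ← hΦY, Function.curry_apply, h1, Function.comp_apply, ← hconst _ h2]
  simp [w, Φ.left_inv h3]

end Coordinates

/-! ### Calculus of the partial derivatives `pd` -/

section PartialDerivatives

variable {f : ℝ → ℝ → ℝ}

theorem pd2_eq_fderiv (hf : ContDiff ℝ ∞ (Function.uncurry f)) (a b : ℝ) :
    pd2 f a b = fderiv ℝ (Function.uncurry f) (a, b) (1, 0) := by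
  have h1 := (hf.differentiable (by simp) (a, b)).hasFDerivAt
  have h2 : HasDerivAt (fun s : ℝ => (s, b)) (1, 0) a :=
    (hasDerivAt_id a).prodMk (hasDerivAt_const a b)
  exact (h1.comp_hasDerivAt a h2).deriv

theorem pd7_eq_fderiv (hf : ContDiff ℝ ∞ (Function.uncurry f)) (a b : ℝ) :
    pd7 f a b = fderiv ℝ (Function.uncurry f) (a, b) (0, 1) := by
  have h1 := (hf.differentiable (by simp) (a, b)).hasFDerivAt
  have h2 : HasDerivAt (fun s : ℝ => (a, s)) (0, 1) b :=
    (hasDerivAt_const b a).prodMk (hasDerivAt_id b)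
  exact (h1.comp_hasDerivAt b h2).deriv

theorem contDiff_pd2 (hf : ContDiff ℝ ∞ (Function.uncurry f)) :
    ContDiff ℝ ∞ (Function.uncurry (pd2 f)) := by
  rw [show Function.uncurry (pd2 f) = fun p => fderiv ℝ (Function.uncurry f) p (1, 0) from
    funext fun p => pd2_eq_fderiv hf p.1 p.2]
  exact (hf.fderiv_right (m := ∞) (by simp)).clm_apply contDiff_const

theorem contDiff_pd7 (hf : ContDiff ℝ ∞ (Function.uncurry f)) :
    ContDiff ℝ ∞ (Function.uncurry (pd7 f)) := by
  rw [show Function.uncurry (pd7 f) = fun p => fderiv ℝ (Function.uncurry f) p (0, 1) from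
    funext fun p => pd7_eq_fderiv hf p.1 p.2]
  exact (hf.fderiv_right (m := ∞) (by simp)).clm_apply contDiff_const

theorem contDiff_pd (hf : ContDiff ℝ ∞ (Function.uncurry f)) (j k : ℕ) :
    ContDiff ℝ ∞ (Function.uncurry (pd f j k)) := by
  have h2 : ContDiff ℝ ∞ (Function.uncurry (pd2^[j] f)) := by
    induction j with
    | zero => exact hf
    | succ j ih => rw [Function.iterate_succ_apply']; exact contDiff_pd2 ih
  unfold pd
  induction k with
  | zero => exact h2
  | succ k ih => rw [Function.iterate_succ_apply']; exact contDiff_pd7 ih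

theorem pd2_pd7 (hf : ContDiff ℝ ∞ (Function.uncurry f)) : pd2 (pd7 f) = pd7 (pd2 f) := by
  ext a b
  have hd : DifferentiableAt ℝ (fderiv ℝ (Function.uncurry f)) (a, b) :=
    (hf.fderiv_right (m := ∞) (by simp)).differentiable (by simp) _
  have key : ∀ v w : ℝ × ℝ, fderiv ℝ (fun p => fderiv ℝ (Function.uncurry f) p w) (a, b) v
      = fderiv ℝ (fderiv ℝ (Function.uncurry f)) (a, b) v w := fun v w => by
    have := hd.hasFDerivAt.clm_apply (hasFDerivAt_const w (a, b))
    rw [this.fderiv]; simp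
  rw [pd2_eq_fderiv (contDiff_pd7 hf), pd7_eq_fderiv (contDiff_pd2 hf),
    show Function.uncurry (pd7 f) = fun p => fderiv ℝ (Function.uncurry f) p (0, 1) from
      funext fun p => pd7_eq_fderiv hf p.1 p.2,
    show Function.uncurry (pd2 f) = fun p => fderiv ℝ (Function.uncurry f) p (1, 0) from
      funext fun p => pd2_eq_fderiv hf p.1 p.2, key, key]
  exact second_derivative_symmetric
    (fun p => (hf.differentiable (by simp) p).hasFDerivAt) hd.hasFDerivAt _ _

theorem pd7_pd (j k : ℕ) : pd7 (pd f j k) = pd f j (k + 1) :=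
  (Function.iterate_succ_apply' pd7 k _).symm

theorem pd2_pd (hf : ContDiff ℝ ∞ (Function.uncurry f)) (j k : ℕ) :
    pd2 (pd f j k) = pd f (j + 1) k := by
  induction k with
  | zero => exact (Function.iterate_succ_apply' pd2 j _).symm
  | succ k ih => rw [← pd7_pd, pd2_pd7 (contDiff_pd hf j k), ih, pd7_pd]

/-- The chain rule for a function of two real variables. -/
theorem hasFDerivAt_comp₂ (hf : ContDiff ℝ ∞ (Function.uncurry f)) {a b : E8 → ℝ}
    {a' b' : E8 →L[ℝ] ℝ} {z : E8} (ha : HasFDerivAt a a' z) (hb : HasFDerivAt b b' z) :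
    HasFDerivAt (fun x => f (a x) (b x))
      (pd2 f (a z) (b z) • a' + pd7 f (a z) (b z) • b') z := by
  have h1 := (hf.differentiable (by simp) (a z, b z)).hasFDerivAt.comp z (ha.prodMk hb)
  refine h1.congr_fderiv ?_
  ext v
  simp only [ContinuousLinearMap.comp_apply, ContinuousLinearMap.prod_apply, add_apply, smul_apply,
    pd2_eq_fderiv hf, pd7_eq_fderiv hf, smul_eq_mul]
  rw [show (a' v, b' v) = a' v • ((1 : ℝ), (0 : ℝ)) + b' v • ((0 : ℝ), (1 : ℝ)) by simp,
    map_add, map_smul, map_smul]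
  simp [mul_comm]

end PartialDerivatives

/-! ### Normal coordinates for the structure equations -/

theorem linearIndependent_of_forall_apply_eq_zero {L : Fin 8 → E8 →L[ℝ] ℝ}
    (hL : ∀ v, (∀ i, L i v = 0) → v = 0) : LinearIndependent ℝ L := by
  have hinj : Function.Injective (ContinuousLinearMap.pi L : E8 →L[ℝ] (Fin 8 → ℝ)) :=
    (injective_iff_map_eq_zero _).2 fun v hv => hL v fun i => congrFun hv i
  have hsurj : Function.Surjective (ContinuousLinearMap.pi L : E8 →L[ℝ] (Fin 8 → ℝ)) :=
    (LinearMap.injective_iff_surjective_of_finrank_eq_finrank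
      (f := (ContinuousLinearMap.pi L : E8 →L[ℝ] (Fin 8 → ℝ)).toLinearMap) (by simp)).1 hinj
  rw [Fintype.linearIndependent_iff]
  intro g hg i
  obtain ⟨v, hv⟩ := hsurj (Pi.single i 1)
  have hv' : ∀ j, L j v = (Pi.single i 1 : Fin 8 → ℝ) j := fun j => congrFun hv j
  have := congrArg (fun A : E8 →L[ℝ] ℝ => A v) hg
  simpa [sum_apply, hv', Pi.single_apply] using this

/-- Twisting a form by a multiple of another one to obtain a closed form, and its potential. -/
theorem exists_potential_add_smul {s : Set E8} (hs : IsOpen s) (hc : Convex ℝ s)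
    {β γ : E8 → E8 →L[ℝ] ℝ} {f : E8 → ℝ} {f' : E8 → E8 →L[ℝ] ℝ}
    (hβ : ContDiffOn ℝ ∞ β s) (hγ : ContDiffOn ℝ ∞ γ s) (hf : ContDiffOn ℝ ∞ f s)
    (hf' : ∀ z ∈ s, HasFDerivAt f (f' z) z)
    (hcl : ∀ z ∈ s, ∀ v w, extD β z v w + f z * extD γ z v w + wedge (f' z) (γ z) v w = 0) :
    ContDiffOn ℝ ∞ (fun z => β z + f z • γ z) s ∧
    ∃ g : E8 → ℝ, ContDiffOn ℝ ∞ g s ∧ ∀ z ∈ s, HasFDerivAt g (β z + f z • γ z) z := by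
  have hsm := hβ.add (hf.smul hγ)
  refine ⟨hsm, exists_potential hs hc hsm fun z hz v w => ?_⟩
  have dβ := (hβ.contDiffAt (hs.mem_nhds hz)).differentiableAt (by simp)
  have dγ := (hγ.contDiffAt (hs.mem_nhds hz)).differentiableAt (by simp)
  have df := (hf' z hz).differentiableAt
  rw [extD_add dβ (df.fun_smul dγ), extD_smul df dγ, (hf' z hz).fderiv, ← hcl z hz v w]
  ring

/-- Every solution of the structure equations with `T = u b⁵` is locally the explicit coframe
determined by a function of two variables. -/
theorem exists_normal_coordinates {O : Set E8} (hO : IsOpen O) {α : Fin 8 → E8 → E8 →L[ℝ] ℝ}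
    {t : E8 → Fin 12 → ℝ} (hα : ∀ i, ContDiffOn ℝ ∞ (α i) O)
    (ht : ContDiffOn ℝ ∞ (fun z => t z 11) O) (ht0 : ∀ z ∈ O, ∀ i, i ≠ 11 → t z i = 0)
    (hli : ∀ z ∈ O, LinearIndependent ℝ fun i => α i z)
    (hse : ∀ z ∈ O, StructureEquations α (t z) z) {z₀ : E8} (hz₀ : z₀ ∈ O) :
    ∃ (Φ : OpenPartialHomeomorph E8 E8) (h : ℝ → ℝ → ℝ), z₀ ∈ Φ.source ∧ Φ.source ⊆ O ∧
      ContDiffOn ℝ ∞ Φ Φ.source ∧ ContDiffOn ℝ ∞ Φ.symm Φ.target ∧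
      ContDiff ℝ ∞ (Function.uncurry h) ∧ ∀ y ∈ Φ.target,
        t (Φ.symm y) 11 = 1 / 2 * pd h 3 0 (y 2) (y 7) ∧
        IsExplicitCoframe h (fun i y => (α i (Φ.symm y)).comp (fderiv ℝ Φ.symm y)) y := by
  obtain ⟨r, hr, hrO⟩ := Metric.nhds_basis_ball.mem_iff.1 (hO.mem_nhds hz₀)
  set B := Metric.ball z₀ r
  have hBo : IsOpen B := Metric.isOpen_ball
  have hBc : Convex ℝ B := convex_ball _ _
  have hzB : z₀ ∈ B := Metric.mem_ball_self hr
  replace hα : ∀ i, ContDiffOn ℝ ∞ (α i) B := fun i => (hα i).mono hrO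
  replace ht : ContDiffOn ℝ ∞ (fun z => t z 11) B := ht.mono hrO
  have heq : ∀ z ∈ B, ∀ v w, let W : Fin 8 → Fin 8 → ℝ := fun i j => wedge (α i z) (α j z) v w
      extD (α 1) z v w = - W 4 7 - W 5 6 ∧ extD (α 2) z v w = - 2 * W 5 7 ∧
      extD (α 3) z v w = t z 11 * W 2 7 - 2 * W 4 6 ∧ extD (α 4) z v w = W 6 8 ∧
      extD (α 5) z v w = W 7 8 ∧ extD (α 6) z v w = 0 ∧ extD (α 7) z v w = 0 ∧
      extD (α 8) z v w = 0 := by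
    intro z hz v w
    have h0 := ht0 z (hrO hz)
    obtain ⟨h1, h2, h3, h4⟩ := hse z (hrO hz) v w
    simp only [h0 1 (by decide), h0 2 (by decide), h0 3 (by decide), h0 4 (by decide),
      h0 5 (by decide), h0 6 (by decide), h0 7 (by decide), h0 8 (by decide), h0 9 (by decide),
      h0 10 (by decide), h0 12 (by decide)] at h1 h2 h3
    refine ⟨?_, ?_, ?_, h4⟩
    · rw [h1]; ring
    · rw [h2]; ring
    · rw [h3]; ring
  obtain ⟨y1, s1, d1⟩ := exists_potential hBo hBc (hα 8) fun z hz v w => (heq z hz v w).2.2.2.2.2.2.2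
  obtain ⟨y2, s2, d2⟩ := exists_potential hBo hBc (hα 7) fun z hz v w => (heq z hz v w).2.2.2.2.2.2.1
  obtain ⟨y3, s3, d3⟩ := exists_potential hBo hBc (hα 6) fun z hz v w => (heq z hz v w).2.2.2.2.2.1
  obtain ⟨c4, y5, s5, d5⟩ := exists_potential_add_smul hBo hBc (hα 4) (hα 6) s1 d1 fun z hz v w => by
    obtain ⟨-, -, -, e4, -, e6, -⟩ := heq z hz v w
    rw [e4, e6]; simp only [wedge]; ring
  obtain ⟨c5, y4, s4, d4⟩ := exists_potential_add_smul hBo hBc (hα 5) (hα 7) s1 d1 fun z hz v w => by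
    obtain ⟨-, -, -, -, e5, -, e7, -⟩ := heq z hz v w
    rw [e5, e7]; simp only [wedge]; ring
  obtain ⟨c2, y7, s7, d7⟩ := exists_potential_add_smul hBo hBc (hα 2) (hα 7)
    (f := fun z => 2 * y4 z) (contDiffOn_const.mul s4) (fun z hz => (d4 z hz).const_mul 2)
    fun z hz v w => by
      obtain ⟨-, e2, -, -, -, -, e7, -⟩ := heq z hz v w
      rw [e2, e7]; simp only [wedge, add_apply, smul_apply, smul_eq_mul]; ring
  have c1 : ContDiffOn ℝ ∞ (fun z => α 1 z + y5 z • α 7 z) B := (hα 1).add (s5.smul (hα 7))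
  have hdα : ∀ i, ∀ z ∈ B, DifferentiableAt ℝ (α i) z := fun i z hz =>
    ((hα i).contDiffAt (hBo.mem_nhds hz)).differentiableAt (by simp)
  obtain ⟨-, y8, s8, d8⟩ := exists_potential_add_smul hBo hBc c1 c5 s3.neg
    (fun z hz => (d3 z hz).neg) fun z hz v w => by
      obtain ⟨e1, -, -, -, -, -, e7, -⟩ := heq z hz v w
      rw [extD_of_hasFDerivAt hBo hz c5 d4, extD_add (hdα 1 z hz)
        ((d5 z hz).differentiableAt.fun_smul (hdα 7 z hz)), extD_smul (d5 z hz).differentiableAt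
        (hdα 7 z hz), e1, e7, (d5 z hz).fderiv]
      simp only [wedge, add_apply, smul_apply, smul_eq_mul, neg_apply]; ring
  have c3 : ContDiffOn ℝ ∞ (fun z => α 3 z + (-2 * y3 z) • (α 4 z + y1 z • α 6 z)) B :=
    (hα 3).add ((contDiffOn_const.mul s3).smul c4)
  have e3 : ∀ z ∈ B, ∀ v w, extD (fun z => α 3 z + (-2 * y3 z) • (α 4 z + y1 z • α 6 z)) z v w
      = t z 11 * wedge (α 2 z + (2 * y4 z) • α 7 z) (α 7 z) v w := by
    intro z hz v w
    obtain ⟨-, -, e3, -⟩ := heq z hz v w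
    have hd := (c4.contDiffAt (hBo.mem_nhds hz)).differentiableAt (by simp)
    rw [extD_add (hdα 3 z hz) (((d3 z hz).const_mul (-2)).differentiableAt.fun_smul hd),
      extD_smul ((d3 z hz).const_mul (-2)).differentiableAt hd, ((d3 z hz).const_mul (-2)).fderiv,
      extD_of_hasFDerivAt hBo hz c4 d5, e3]
    simp only [wedge, add_apply, smul_apply, smul_eq_mul]; ring
  -- `u` depends on `y₂`, `y₇` only
  have hker : ∀ z ∈ B, ∀ x, α 7 z x = 0 → (α 2 z + (2 * y4 z) • α 7 z) x = 0 →
      fderiv ℝ (fun z => t z 11) z x = 0 := by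
    intro z hz x h7 h2
    -- On the dual vectors `v`, `w` the 2-form `dy₇ ∧ dy₂` equals `1`, and both other terms of the
    -- cyclic sum contain `dy₇` or `dy₂` evaluated at `x`, hence vanish.
    obtain ⟨v, hv⟩ := exists_apply_eq (hli z (hrO hz)) (Pi.single 2 1)
    obtain ⟨w, hw⟩ := exists_apply_eq (hli z (hrO hz)) (Pi.single 7 1)
    have := cyclic_sum_eq_zero hBo hz c3
      ((c2.contDiffAt (hBo.mem_nhds hz)).differentiableAt (by simp)) (hdα 7 z hz)
      ((ht.contDiffAt (hBo.mem_nhds hz)).differentiableAt (by simp))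
      (extD_of_hasFDerivAt hBo hz c2 d7) (extD_of_hasFDerivAt hBo hz (hα 7) d2) e3 x v w
    simp only [add_apply, smul_apply, smul_eq_mul, h7, mul_zero, add_zero] at h2
    simpa [wedge, h2, h7, hv, hw] using this
  obtain ⟨V, hV, hVu⟩ : ∃ V : ℝ → ℝ → ℝ, ContDiff ℝ ∞ (Function.uncurry V) ∧
      ∀ᶠ z in 𝓝 z₀, t z 11 = V (y2 z) (y7 z) := by
    -- Provisional coordinates: `y₆` is not yet available, and the linear function `α 3 z₀` stands
    -- in for it, which suffices because only `y₂` and `y₇` are used. The lists start with `y₈`,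
    -- since the literal `8` is the index `0`.
    let L : Fin 8 → E8 → E8 →L[ℝ] ℝ := fun i z => (![fun z => (α 1 z + y5 z • α 7 z)
      + -y3 z • (α 5 z + y1 z • α 7 z), α 8, α 7, α 6, fun z => α 5 z + y1 z • α 7 z,
      fun z => α 4 z + y1 z • α 6 z, fun _ => α 3 z₀, fun z => α 2 z + (2 * y4 z) • α 7 z] : Fin 8 → E8 → E8 →L[ℝ] ℝ) i z
    let Y : Fin 8 → E8 → ℝ := ![y8, y1, y2, y3, y4, y5, fun z => α 3 z₀ z, y7]
    have hL : ∀ i, ∀ z ∈ B, HasFDerivAt (Y i) (L i z) z := by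
      intro i z hz
      fin_cases i
      exacts [d8 z hz, d1 z hz, d2 z hz, d3 z hz, d4 z hz, d5 z hz, (α 3 z₀).hasFDerivAt, d7 z hz]
    obtain ⟨Φ, h1, h2, h3, h4, h5⟩ := exists_coordinates (Y := Y) (L := L) hBo hzB
      (by
        intro i
        fin_cases i
        exacts [s8, s1, s2, s3, s4, s5, (α 3 z₀).contDiff.contDiffOn, s7]) hL
      (linearIndependent_of_forall_apply_eq_zero fun v hv => by
        refine eq_zero_of_apply_eq_zero (hli z₀ hz₀) ?_
        have k1 : α 8 z₀ v = 0 := hv 1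
        have k2 : α 7 z₀ v = 0 := hv 2
        have k3 : α 6 z₀ v = 0 := hv 3
        have k4 : (α 5 z₀ + y1 z₀ • α 7 z₀) v = 0 := hv 4
        have k5 : (α 4 z₀ + y1 z₀ • α 6 z₀) v = 0 := hv 5
        have k6 : α 3 z₀ v = 0 := hv 6
        have k7 : (α 2 z₀ + (2 * y4 z₀) • α 7 z₀) v = 0 := hv 7
        have k8 : ((α 1 z₀ + y5 z₀ • α 7 z₀) + -y3 z₀ • (α 5 z₀ + y1 z₀ • α 7 z₀)) v = 0 := hv 8
        simp only [add_apply, smul_apply, smul_eq_mul, k2, k3, mul_zero, add_zero] at k4 k5 k7 k8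
        simp only [k4, mul_zero, add_zero] at k8
        intro i
        fin_cases i
        exacts [k1, k8, k7, k6, k5, k4, k3, k2])
    exact exists_eventuallyEq_of_fderiv_eq_zero h1 h3 h5 (fun z hz => hL 2 z (h2 hz))
      (fun z hz => hL 7 z (h2 hz)) (ht.mono h2) fun z hz => hker z (h2 hz)
  -- The factor `2` produces `u = ½h₂₂₂`.
  obtain ⟨h, hh, hhV⟩ := exists_pd_three_zero (f := fun a b => 2 * V a b)
    (contDiff_const.mul hV)
  have hVh : ∀ a b, V a b = 1 / 2 * pd h 3 0 a b := fun a b => by rw [hhV]; ring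
  -- The identity `u = V(y₂, y₇)` is known only near `z₀`; a smaller ball keeps the convexity needed
  -- for the last potential.
  obtain ⟨ρ, hρ, hρs⟩ := Metric.nhds_basis_ball.mem_iff.1 (inter_mem (hBo.mem_nhds hzB) hVu)
  set B' := Metric.ball z₀ ρ
  have hBo' : IsOpen B' := Metric.isOpen_ball
  have hB'B : B' ⊆ B := hρs.trans inter_subset_left
  have hu : ∀ z ∈ B', t z 11 = V (y2 z) (y7 z) := fun z hz => (hρs hz).2
  have dg : ∀ z ∈ B', HasFDerivAt (fun z => 1 / 2 * pd h 2 0 (y2 z) (y7 z)) ((1 / 2 : ℝ) •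
      (pd h 3 0 (y2 z) (y7 z) • α 7 z
        + pd h 2 1 (y2 z) (y7 z) • (α 2 z + (2 * y4 z) • α 7 z))) z := fun z hz => by
    have := (hasFDerivAt_comp₂ (contDiff_pd hh 2 0) (d2 z (hB'B hz)) (d7 z (hB'B hz))).const_mul
      (1 / 2)
    rwa [pd2_pd hh, pd7_pd] at this
  have sg : ContDiffOn ℝ ∞ (fun z => 1 / 2 * pd h 2 0 (y2 z) (y7 z)) B' :=
    contDiffOn_const.mul ((contDiff_pd hh 2 0).comp_contDiffOn ((s2.prodMk s7).mono hB'B))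
  obtain ⟨-, y6, s6, d6⟩ := exists_potential_add_smul hBo' (convex_ball _ _)
    (c3.mono hB'B) (c2.mono hB'B) sg dg fun z hz v w => by
      rw [e3 z (hB'B hz), hu z hz, hVh, extD_of_hasFDerivAt hBo (hB'B hz) c2 d7]
      simp only [wedge, add_apply, smul_apply, smul_eq_mul]; ring
  let L : Fin 8 → E8 → E8 →L[ℝ] ℝ := fun i z => (![fun z => (α 1 z + y5 z • α 7 z)
      + -y3 z • (α 5 z + y1 z • α 7 z), α 8, α 7, α 6, fun z => α 5 z + y1 z • α 7 z,
      fun z => α 4 z + y1 z • α 6 z,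
      fun z => (α 3 z + (-2 * y3 z) • (α 4 z + y1 z • α 6 z))
        + (1 / 2 * pd h 2 0 (y2 z) (y7 z)) • (α 2 z + (2 * y4 z) • α 7 z),
      fun z => α 2 z + (2 * y4 z) • α 7 z] : Fin 8 → E8 → E8 →L[ℝ] ℝ) i z
  let Y : Fin 8 → E8 → ℝ := ![y8, y1, y2, y3, y4, y5, y6, y7]
  have hL : ∀ i, ∀ z ∈ B', HasFDerivAt (Y i) (L i z) z := by
    intro i z hz
    have hz' := hB'B hz
    fin_cases i
    exacts [d8 z hz', d1 z hz', d2 z hz', d3 z hz', d4 z hz', d5 z hz', d6 z hz, d7 z hz']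
  obtain ⟨Φ, h1, h2, h3, h4, h5⟩ := exists_coordinates (Y := Y) (L := L) hBo'
    (Metric.mem_ball_self hρ)
    (by
      intro i
      fin_cases i
      exacts [s8.mono hB'B, s1.mono hB'B, s2.mono hB'B, s3.mono hB'B, s4.mono hB'B, s5.mono hB'B,
        s6, s7.mono hB'B]) hL
    (linearIndependent_of_forall_apply_eq_zero fun v hv => by
      refine eq_zero_of_apply_eq_zero (hli z₀ hz₀) ?_
      have k1 : α 8 z₀ v = 0 := hv 1
      have k2 : α 7 z₀ v = 0 := hv 2
      have k3 : α 6 z₀ v = 0 := hv 3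
      have k4 : (α 5 z₀ + y1 z₀ • α 7 z₀) v = 0 := hv 4
      have k5 : (α 4 z₀ + y1 z₀ • α 6 z₀) v = 0 := hv 5
      have k6 : ((α 3 z₀ + (-2 * y3 z₀) • (α 4 z₀ + y1 z₀ • α 6 z₀))
        + (1 / 2 * pd h 2 0 (y2 z₀) (y7 z₀)) • (α 2 z₀ + (2 * y4 z₀) • α 7 z₀)) v = 0 := hv 6
      have k7 : (α 2 z₀ + (2 * y4 z₀) • α 7 z₀) v = 0 := hv 7
      have k8 : ((α 1 z₀ + y5 z₀ • α 7 z₀) + -y3 z₀ • (α 5 z₀ + y1 z₀ • α 7 z₀)) v = 0 := hv 8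
      simp only [add_apply, smul_apply, smul_eq_mul, k2, k3, mul_zero, add_zero] at k4 k5 k6 k7 k8
      simp only [k4, k5, k7, mul_zero, add_zero] at k6 k8
      intro i
      fin_cases i
      exacts [k1, k8, k7, k6, k5, k4, k3, k2])
  refine ⟨Φ, h, h1, h2.trans (hB'B.trans hrO), h4, h5, hh, fun y hy => ?_⟩
  have hz := Φ.map_target hy
  have hy' : ∀ i, Y i (Φ.symm y) = y i := fun i => by rw [← h3, Φ.right_inv hy]
  have hpull : ∀ i, (L i (Φ.symm y)).comp (fderiv ℝ Φ.symm y) = dy i := fun i =>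
    comp_fderiv_symm h5 (fun z => h3 z i) hy (hL i _ (h2 hz))
  have v1 : y1 (Φ.symm y) = y 1 := hy' 1
  have v2 : y2 (Φ.symm y) = y 2 := hy' 2
  have v3 : y3 (Φ.symm y) = y 3 := hy' 3
  have v4 : y4 (Φ.symm y) = y 4 := hy' 4
  have v5 : y5 (Φ.symm y) = y 5 := hy' 5
  have v7 : y7 (Φ.symm y) = y 7 := hy' 7
  refine ⟨by rw [hu _ (h2 hz), hVh, v2, v7], ?_⟩
  set A := fderiv ℝ Φ.symm y
  set z := Φ.symm y
  -- In the new coordinates the eight closed forms are the `dyᵢ`; solving this triangular system for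
  -- the `αᵢ` gives the explicit coframe.
  have P : ∀ i x, L i z (A x) = dy i x := fun i x =>
    congrArg (fun T : E8 →L[ℝ] ℝ => T x) (hpull i)
  have p1 : ∀ x, α 8 z (A x) = dy 1 x := P 1
  have p2 : ∀ x, α 7 z (A x) = dy 2 x := P 2
  have p3 : ∀ x, α 6 z (A x) = dy 3 x := P 3
  have p4 : ∀ x, (α 5 z + y1 z • α 7 z) (A x) = dy 4 x := P 4
  have p5 : ∀ x, (α 4 z + y1 z • α 6 z) (A x) = dy 5 x := P 5
  have p6 : ∀ x, ((α 3 z + (-2 * y3 z) • (α 4 z + y1 z • α 6 z))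
        + (1 / 2 * pd h 2 0 (y2 z) (y7 z)) • (α 2 z + (2 * y4 z) • α 7 z)) (A x) = dy 6 x := P 6
  have p7 : ∀ x, (α 2 z + (2 * y4 z) • α 7 z) (A x) = dy 7 x := P 7
  have p8 : ∀ x, ((α 1 z + y5 z • α 7 z) + -y3 z • (α 5 z + y1 z • α 7 z)) (A x) = dy 8 x := P 8
  simp only [add_apply, smul_apply, smul_eq_mul, v1, v2, v3, v4, v5, v7] at p4 p5 p6 p7 p8
  refine ⟨?_, ?_, ?_, ?_, ?_, ?_, ?_, ?_⟩ <;> ext x <;>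
    simp only [add_apply, sub_apply, smul_apply, smul_eq_mul, ContinuousLinearMap.comp_apply]
  · linear_combination p8 x - y 5 * p2 x + y 3 * p4 x
  · linear_combination p7 x - 2 * y 4 * p2 x
  · linear_combination p6 x + 2 * y 3 * p5 x - 1 / 2 * pd h 2 0 (y 2) (y 7) * p7 x
  · linear_combination p5 x - y 1 * p3 x
  · linear_combination p4 x - y 1 * p2 x
  · exact p3 x
  · exact p2 x
  · exact p1 x

/-! ### Transfer between the manifold and its charts -/

section Charts

variable {M : Type*} [TopologicalSpace M] [ChartedSpace E8 M]

theorem mdifferentiable_of_mem_maximalAtlas {e : OpenPartialHomeomorph M E8}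
    (he : e ∈ IsManifold.maximalAtlas (𝓡 8) ∞ M) : e.MDifferentiable (𝓡 8) (𝓡 8) :=
  ⟨(contMDiffOn_of_mem_maximalAtlas he).mdifferentiableOn (by simp),
    (contMDiffOn_symm_of_mem_maximalAtlas he).mdifferentiableOn (by simp)⟩

theorem linearIndependent_inChart {e : OpenPartialHomeomorph M E8}
    (he : e ∈ IsManifold.maximalAtlas (𝓡 8) ∞ M) {om : FormFamily M}
    (hli : ∀ x, LinearIndependent ℝ fun i => om i x) {z : E8} (hz : z ∈ e.target) :
    LinearIndependent ℝ fun i => inChart e om i z :=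
  linearIndependent_of_forall_apply_eq_zero fun v hv => by
    have hinj := (mdifferentiable_of_mem_maximalAtlas he).symm.mfderiv_injective hz
    have h0 : mfderiv (𝓡 8) (𝓡 8) e.symm z v = 0 :=
      eq_zero_of_apply_eq_zero (hli (e.symm z)) hv
    exact hinj (h0.trans (map_zero _).symm)

/-- Around every point there is a chart in which the coframe is explicit. -/
theorem exists_normal_chart [IsManifold (𝓡 8) ∞ M] {om : FormFamily M} {t : Fin 12 → M → ℝ} (hom : IsMongeCoframe om t)
    (hnorm : ∀ i, i ≠ 11 → ∀ x, t i x = 0) (p : M) :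
    ∃ e ∈ IsManifold.maximalAtlas (𝓡 8) ∞ M, p ∈ e.source ∧
      ∃ h : ℝ → ℝ → ℝ, ContDiff ℝ ∞ (Function.uncurry h) ∧ ∀ y ∈ e.target,
        IsExplicitCoframe h (inChart e om) y ∧
        t 11 (e.symm y) = 1 / 2 * pd h 3 0 (y 2) (y 7) := by
  set e₀ := chartAt E8 p
  have ha : e₀ ∈ atlas E8 M := chart_mem_atlas E8 p
  have hm : e₀ ∈ IsManifold.maximalAtlas (𝓡 8) ∞ M := IsManifold.chart_mem_maximalAtlas p
  have hd := mdifferentiable_of_mem_maximalAtlas hm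
  obtain ⟨Φ, h, h1, h2, h3, h4, hh, h5⟩ := exists_normal_coordinates (α := inChart e₀ om)
    (t := fun z i => t i (e₀.symm z)) e₀.open_target (fun i => hom.smooth_form i e₀ ha)
    (contMDiffOn_iff_contDiffOn.1
      ((hom.smooth_coeff 11).comp_contMDiffOn (contMDiffOn_symm_of_mem_maximalAtlas hm)))
    (fun z _ i hi => hnorm i hi _) (fun z hz => linearIndependent_inChart hm hom.linearIndependent hz)
    (fun z hz => hom.structure_eq e₀ ha z hz) (mem_chart_target E8 p)
  refine ⟨e₀.trans Φ, ?_, ⟨mem_chart_source E8 p, h1⟩, h, hh, fun y hy => ?_⟩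
  · refine OpenPartialHomeomorph.mem_maximalAtlas_of_contMDiffOn _ ?_ ?_
    · exact (contMDiffOn_iff_contDiffOn.2 h3).comp
        ((contMDiffOn_of_mem_maximalAtlas hm).mono fun x hx => hx.1) fun x hx => hx.2
    · exact (contMDiffOn_symm_of_mem_maximalAtlas hm).comp
        ((contMDiffOn_iff_contDiffOn.2 h4).mono fun x hx => hx.1) fun x hx => hx.2
  · have hy1 : y ∈ Φ.target := hy.1
    have hy2 : Φ.symm y ∈ e₀.target := hy.2
    obtain ⟨hu, hc⟩ := h5 y hy1
    have hder : mfderiv (𝓡 8) (𝓡 8) (e₀.trans Φ).symm y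
        = (mfderiv (𝓡 8) (𝓡 8) e₀.symm (Φ.symm y)).comp (mfderiv (𝓡 8) (𝓡 8) Φ.symm y) :=
      mfderiv_comp y (hd.mdifferentiableAt_symm hy2)
        ((h4.contDiffAt (Φ.open_target.mem_nhds hy1)).differentiableAt (by simp)).mdifferentiableAt
    refine ⟨?_, hu⟩
    have key : ∀ i, inChart (e₀.trans Φ) om i y
        = (inChart e₀ om i (Φ.symm y)).comp (fderiv ℝ Φ.symm y) := by
      intro i
      have h6 : inChart (e₀.trans Φ) om i y
          = (inChart e₀ om i (Φ.symm y)).comp (mfderiv (𝓡 8) (𝓡 8) Φ.symm y) := by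
        unfold inChart
        rw [hder]
        rfl
      exact h6.trans (congrArg (inChart e₀ om i (Φ.symm y)).comp mfderiv_eq_fderiv)
    simpa only [IsExplicitCoframe, key] using hc

/-- The derivative of the inverse chart is onto the tangent space, so a proposed differential need
only be tested on its image, where it becomes a computation in coordinates. -/
theorem hasDifferential_of_chart {e : OpenPartialHomeomorph M E8}
    (he : e ∈ IsManifold.maximalAtlas (𝓡 8) ∞ M) {f : M → ℝ} {G : E8 → ℝ} {G' : E8 →L[ℝ] ℝ} {y : E8}
    (hy : y ∈ e.target) (hfG : ∀ y ∈ e.target, f (e.symm y) = G y) (hG : HasFDerivAt G G' y)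
    {df : TangentSpace (𝓡 8) (e.symm y) →L[ℝ] ℝ}
    (hdf : ∀ v, df (mfderiv (𝓡 8) (𝓡 8) e.symm y v) = G' v) :
    HasDifferential f (e.symm y) df := by
  have hd := mdifferentiable_of_mem_maximalAtlas he
  have hs := e.map_target hy
  have h1 : HasMFDerivAt (𝓡 8) (𝓡 8) e (e.symm y) (mfderiv (𝓡 8) (𝓡 8) e (e.symm y)) :=
    (hd.mdifferentiableAt hs).hasMFDerivAt
  have h2 : HasMFDerivAt (𝓡 8) 𝓘(ℝ, ℝ) G (e (e.symm y)) G' := by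
    rw [e.right_inv hy]; exact hG.hasMFDerivAt
  have h3 := h2.comp (e.symm y) h1
  have h4 : f =ᶠ[𝓝 (e.symm y)] G ∘ e := by
    filter_upwards [e.open_source.mem_nhds hs] with x hx
    rw [Function.comp_apply, ← hfG _ (e.map_source hx), e.left_inv hx]
  have h5 := h3.congr_of_eventuallyEq h4
  suffices h6 : df = G'.comp (mfderiv (𝓡 8) (𝓡 8) e (e.symm y)) by rw [h6]; exact h5
  refine ContinuousLinearMap.ext fun w => ?_
  obtain ⟨v, rfl⟩ := hd.symm.mfderiv_surjective hy w
  refine (hdf v).trans ?_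
  have h6 := congrArg (fun T => T v) (hd.comp_symm_deriv hy)
  exact (congrArg G' h6).symm

end Charts

/-! ### Differentials of polynomials in `y₁`, `y₄` and derivatives of `h` -/

noncomputable section Monomials

/-- The monomials in `y₁`, `y₄` and the derivatives of `h` that occur in the derived quantities. -/
def derivMonomial (h : ℝ → ℝ → ℝ) (c : ℝ) (a b j k : ℕ) (y : E8) : ℝ :=
  c * y 1 ^ a * y 4 ^ b * pd h j k (y 2) (y 7)

/-- The differential of `derivMonomial`. -/
def derivMonomialDiff (h : ℝ → ℝ → ℝ) (c : ℝ) (a b j k : ℕ) (y : E8) : E8 →L[ℝ] ℝ :=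
  -- The truncated exponent at `a = 0` is harmless, because the factor `a` is then zero; likewise
  -- for `b` below.
  (c * (a * y 1 ^ (a - 1)) * y 4 ^ b * pd h j k (y 2) (y 7)) • dy 1
    + (c * y 1 ^ a * (b * y 4 ^ (b - 1)) * pd h j k (y 2) (y 7)) • dy 4
    + (c * y 1 ^ a * y 4 ^ b * pd h (j + 1) k (y 2) (y 7)) • dy 2
    + (c * y 1 ^ a * y 4 ^ b * pd h j (k + 1) (y 2) (y 7)) • dy 7

theorem hasFDerivAt_derivMonomial {h : ℝ → ℝ → ℝ} (hh : ContDiff ℝ ∞ (Function.uncurry h)) (c : ℝ)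
    (a b j k : ℕ) (y : E8) :
    HasFDerivAt (derivMonomial h c a b j k) (derivMonomialDiff h c a b j k y) y := by
  have hc : ∀ i, HasFDerivAt (fun x : E8 => x i) (dy i) y := fun i => (dy i).hasFDerivAt
  have h0 := hasFDerivAt_comp₂ (contDiff_pd hh j k) (hc 2) (hc 7)
  rw [pd2_pd hh, pd7_pd] at h0
  have h1 := (((HasFDerivAt.pow (hc 1) a).const_mul c).mul (HasFDerivAt.pow (hc 4) b)).mul h0
  refine h1.congr_fderiv ?_
  ext v
  simp only [derivMonomialDiff, add_apply, smul_apply, smul_eq_mul, nsmul_eq_mul, Pi.mul_apply]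
  ring

/-- A sum of monomials `derivMonomial`, given by the list of their coefficients and exponents. -/
def derivSum (h : ℝ → ℝ → ℝ) (l : List (ℝ × ℕ × ℕ × ℕ × ℕ)) (y : E8) : ℝ :=
  (l.map fun m => derivMonomial h m.1 m.2.1 m.2.2.1 m.2.2.2.1 m.2.2.2.2 y).sum

/-- The differential of `derivSum`. -/
def derivSumDiff (h : ℝ → ℝ → ℝ) (l : List (ℝ × ℕ × ℕ × ℕ × ℕ)) (y : E8) : E8 →L[ℝ] ℝ :=
  (l.map fun m => derivMonomialDiff h m.1 m.2.1 m.2.2.1 m.2.2.2.1 m.2.2.2.2 y).sum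

theorem hasFDerivAt_derivSum {h : ℝ → ℝ → ℝ} (hh : ContDiff ℝ ∞ (Function.uncurry h))
    (l : List (ℝ × ℕ × ℕ × ℕ × ℕ)) (y : E8) :
    HasFDerivAt (derivSum h l) (derivSumDiff h l y) y := by
  induction l with
  | nil => exact hasFDerivAt_const 0 y
  | cons m l ih =>
    have h1 := (hasFDerivAt_derivMonomial hh m.1 m.2.1 m.2.2.1 m.2.2.2.1 m.2.2.2.2 y).add ih
    have h2 : derivSum h (m :: l)
        = derivMonomial h m.1 m.2.1 m.2.2.1 m.2.2.2.1 m.2.2.2.2 + derivSum h l := by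
      ext x; simp [derivSum]
    rw [h2, derivSumDiff, List.map_cons, List.sum_cons]
    exact h1

end Monomials

/-! ### Local uniqueness and local solutions of the derived system -/

section Derived

variable {M : Type*} [TopologicalSpace M] [ChartedSpace E8 M]

/-- The differential equations of `IsDerived` at a single point. -/
def IsDerivedAt (om : FormFamily M) (u : M → ℝ) (q : DerivedFunctions M) (x : M) : Prop :=
  HasDifferential u x (q.v₁ x • om 2 x + q.v₂ x • om 7 x) ∧
  HasDifferential q.v₁ x (q.w₁ x • om 2 x + q.w₂ x • om 7 x) ∧
  HasDifferential q.v₂ x (q.w₂ x • om 2 x + (2 * q.v₁ x) • om 5 x + q.w₃ x • om 7 x) ∧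
  HasDifferential q.w₁ x (q.z₁ x • om 2 x + q.z₂ x • om 7 x) ∧
  HasDifferential q.w₂ x (q.z₂ x • om 2 x + (2 * q.w₁ x) • om 5 x + q.z₃ x • om 7 x) ∧
  HasDifferential q.w₃ x (q.z₃ x • om 2 x + (4 * q.w₂ x) • om 5 x + q.z₄ x • om 7 x
    + (2 * q.v₁ x) • om 8 x) ∧
  HasDifferential q.z₁ x (q.z₅ x • om 2 x + q.z₆ x • om 7 x) ∧
  HasDifferential q.z₂ x (q.z₆ x • om 2 x + (2 * q.z₁ x) • om 5 x + q.z₇ x • om 7 x) ∧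
  HasDifferential q.z₃ x (q.z₇ x • om 2 x + (4 * q.z₂ x) • om 5 x + q.z₈ x • om 7 x
    + (2 * q.w₁ x) • om 8 x) ∧
  HasDifferential q.z₄ x (q.z₈ x • om 2 x + (6 * q.z₃ x) • om 5 x + q.z₉ x • om 7 x
    + (6 * q.w₂ x) • om 8 x)

/-- The values of the derived quantities at a point. -/
def DerivedFunctions.eval {M : Type*} (q : DerivedFunctions M) (x : M) : DerivedFunctions Unit :=
  ⟨fun _ => q.v₁ x, fun _ => q.v₂ x, fun _ => q.w₁ x, fun _ => q.w₂ x, fun _ => q.w₃ x,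
    fun _ => q.z₁ x, fun _ => q.z₂ x, fun _ => q.z₃ x, fun _ => q.z₄ x, fun _ => q.z₅ x,
    fun _ => q.z₆ x, fun _ => q.z₇ x, fun _ => q.z₈ x, fun _ => q.z₉ x⟩

/-- One shape covers all ten equations, with zero coefficients where `ω⁵` or `ω⁸` is absent. Only
the `ω²` and `ω⁷` coefficients carry new unknowns; they are read off on the dual vectors of the
coframe. -/
theorem coefficients_eq {om : FormFamily M} {x : M} (hli : LinearIndependent ℝ fun i => om i x)
    {f g : M → ℝ} (hfg : f =ᶠ[𝓝 x] g) {df dg : TangentSpace (𝓡 8) x →L[ℝ] ℝ}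
    (hf : HasDifferential f x df) (hg : HasDifferential g x dg)
    {a₂ a₅ a₇ a₈ b₂ b₅ b₇ b₈ : ℝ}
    (hdf : df = a₂ • om 2 x + a₅ • om 5 x + a₇ • om 7 x + a₈ • om 8 x)
    (hdg : dg = b₂ • om 2 x + b₅ • om 5 x + b₇ • om 7 x + b₈ • om 8 x) :
    a₂ = b₂ ∧ a₇ = b₇ := by
  have heq : df = dg := hasMFDerivAt_unique hf (hg.congr_of_eventuallyEq hfg)
  have key : ∀ i, ∃ v : TangentSpace (𝓡 8) x, ∀ j, om j x v = (Pi.single i 1 : Fin 8 → ℝ) j :=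
    fun i => exists_apply_eq hli (Pi.single i 1)
  obtain ⟨v, hv⟩ := key 2
  obtain ⟨w, hw⟩ := key 7
  rw [hdf, hdg] at heq
  have h2 := congrArg (fun T : TangentSpace (𝓡 8) x →L[ℝ] ℝ => T v) heq
  have h7 := congrArg (fun T : TangentSpace (𝓡 8) x →L[ℝ] ℝ => T w) heq
  simp only [add_apply, smul_apply, hv, hw, smul_eq_mul] at h2 h7
  exact ⟨by simpa using h2, by simpa using h7⟩

/-- The derived quantities are determined locally. -/
theorem eval_eq_eval {om : FormFamily M} (hli : ∀ x, LinearIndependent ℝ fun i => om i x)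
    {u : M → ℝ} {q q' : DerivedFunctions M} {s : Set M} (hs : IsOpen s)
    (hq : ∀ x ∈ s, IsDerivedAt om u q x) (hq' : ∀ x ∈ s, IsDerivedAt om u q' x) {x : M}
    (hx : x ∈ s) : q.eval x = q'.eval x := by
  have step : ∀ {f g : M → ℝ}, (∀ x ∈ s, f x = g x) → ∀ x ∈ s, f =ᶠ[𝓝 x] g :=
    fun h x hx => eventually_of_mem (hs.mem_nhds hx) h
  -- Uniqueness climbs by order: equality of two functions on the open set `s` gives equality of
  -- germs, hence of differentials, hence of the next coefficients.
  have hv : ∀ x ∈ s, q.v₁ x = q'.v₁ x ∧ q.v₂ x = q'.v₂ x := fun x hx =>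
    coefficients_eq (a₅ := 0) (a₈ := 0) (b₅ := 0) (b₈ := 0) (hli x)
      (step (fun _ _ => rfl) x hx) (hq x hx).1 (hq' x hx).1 (by simp) (by simp)
  have hw : ∀ x ∈ s, q.w₁ x = q'.w₁ x ∧ q.w₂ x = q'.w₂ x := fun x hx =>
    coefficients_eq (a₅ := 0) (a₈ := 0) (b₅ := 0) (b₈ := 0) (hli x)
      (step (fun x hx => (hv x hx).1) x hx) (hq x hx).2.1 (hq' x hx).2.1 (by simp) (by simp)
  have hw' : ∀ x ∈ s, q.w₂ x = q'.w₂ x ∧ q.w₃ x = q'.w₃ x := fun x hx =>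
    coefficients_eq (a₅ := 2 * q.v₁ x) (a₈ := 0) (b₅ := 2 * q'.v₁ x) (b₈ := 0) (hli x) (step (fun x hx => (hv x hx).2) x hx)
      (hq x hx).2.2.1 (hq' x hx).2.2.1 (by rw [zero_smul, add_zero]) (by rw [zero_smul, add_zero])
  have hz₁ : ∀ x ∈ s, q.z₁ x = q'.z₁ x ∧ q.z₂ x = q'.z₂ x := fun x hx =>
    coefficients_eq (a₅ := 0) (a₈ := 0) (b₅ := 0) (b₈ := 0) (hli x)
      (step (fun x hx => (hw x hx).1) x hx) (hq x hx).2.2.2.1 (hq' x hx).2.2.2.1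
      (by simp) (by simp)
  have hz₂ : ∀ x ∈ s, q.z₂ x = q'.z₂ x ∧ q.z₃ x = q'.z₃ x := fun x hx =>
    coefficients_eq (a₅ := 2 * q.w₁ x) (a₈ := 0) (b₅ := 2 * q'.w₁ x) (b₈ := 0) (hli x) (step (fun x hx => (hw x hx).2) x hx)
      (hq x hx).2.2.2.2.1 (hq' x hx).2.2.2.2.1 (by rw [zero_smul, add_zero])
      (by rw [zero_smul, add_zero])
  have hz₃ : ∀ x ∈ s, q.z₃ x = q'.z₃ x ∧ q.z₄ x = q'.z₄ x := fun x hx =>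
    coefficients_eq (hli x) (step (fun x hx => (hw' x hx).2) x hx)
      (hq x hx).2.2.2.2.2.1 (hq' x hx).2.2.2.2.2.1 rfl rfl
  have hy₁ : ∀ x ∈ s, q.z₅ x = q'.z₅ x ∧ q.z₆ x = q'.z₆ x := fun x hx =>
    coefficients_eq (a₅ := 0) (a₈ := 0) (b₅ := 0) (b₈ := 0) (hli x)
      (step (fun x hx => (hz₁ x hx).1) x hx) (hq x hx).2.2.2.2.2.2.1 (hq' x hx).2.2.2.2.2.2.1
      (by simp) (by simp)
  have hy₂ : ∀ x ∈ s, q.z₆ x = q'.z₆ x ∧ q.z₇ x = q'.z₇ x := fun x hx =>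
    coefficients_eq (a₅ := 2 * q.z₁ x) (a₈ := 0) (b₅ := 2 * q'.z₁ x) (b₈ := 0) (hli x) (step (fun x hx => (hz₁ x hx).2) x hx)
      (hq x hx).2.2.2.2.2.2.2.1 (hq' x hx).2.2.2.2.2.2.2.1 (by rw [zero_smul, add_zero])
      (by rw [zero_smul, add_zero])
  have hy₃ : ∀ x ∈ s, q.z₇ x = q'.z₇ x ∧ q.z₈ x = q'.z₈ x := fun x hx =>
    coefficients_eq (hli x) (step (fun x hx => (hz₂ x hx).2) x hx)
      (hq x hx).2.2.2.2.2.2.2.2.1 (hq' x hx).2.2.2.2.2.2.2.2.1 rfl rfl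
  have hy₄ : ∀ x ∈ s, q.z₈ x = q'.z₈ x ∧ q.z₉ x = q'.z₉ x := fun x hx =>
    coefficients_eq (hli x) (step (fun x hx => (hz₃ x hx).2) x hx)
      (hq x hx).2.2.2.2.2.2.2.2.2 (hq' x hx).2.2.2.2.2.2.2.2.2 rfl rfl
  simp only [DerivedFunctions.eval, hv x hx, hw x hx, hw' x hx, hz₁ x hx, hz₂ x hx, hz₃ x hx,
    hy₁ x hx, hy₂ x hx, hy₃ x hx, hy₄ x hx]

/-- Being derived at a point only depends on the germs of the functions. -/
theorem IsDerivedAt.congr {om : FormFamily M} {u : M → ℝ} {q q' : DerivedFunctions M} {x : M}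
    (hq : IsDerivedAt om u q x) (hqq' : ∀ᶠ y in 𝓝 x, q'.eval y = q.eval y) :
    IsDerivedAt om u q' x := by
  have key : ∀ f : DerivedFunctions Unit → Unit → ℝ,
      ∀ᶠ y in 𝓝 x, f (q'.eval y) () = f (q.eval y) () := fun f => by
    filter_upwards [hqq'] with y hy
    rw [hy]
  have hv₁ : q'.v₁ =ᶠ[𝓝 x] q.v₁ := key DerivedFunctions.v₁
  have hv₂ : q'.v₂ =ᶠ[𝓝 x] q.v₂ := key DerivedFunctions.v₂
  have hw₁ : q'.w₁ =ᶠ[𝓝 x] q.w₁ := key DerivedFunctions.w₁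
  have hw₂ : q'.w₂ =ᶠ[𝓝 x] q.w₂ := key DerivedFunctions.w₂
  have hw₃ : q'.w₃ =ᶠ[𝓝 x] q.w₃ := key DerivedFunctions.w₃
  have hz₁ : q'.z₁ =ᶠ[𝓝 x] q.z₁ := key DerivedFunctions.z₁
  have hz₂ : q'.z₂ =ᶠ[𝓝 x] q.z₂ := key DerivedFunctions.z₂
  have hz₃ : q'.z₃ =ᶠ[𝓝 x] q.z₃ := key DerivedFunctions.z₃
  have hz₄ : q'.z₄ =ᶠ[𝓝 x] q.z₄ := key DerivedFunctions.z₄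
  have hz₅ : q'.z₅ =ᶠ[𝓝 x] q.z₅ := key DerivedFunctions.z₅
  have hz₆ : q'.z₆ =ᶠ[𝓝 x] q.z₆ := key DerivedFunctions.z₆
  have hz₇ : q'.z₇ =ᶠ[𝓝 x] q.z₇ := key DerivedFunctions.z₇
  have hz₈ : q'.z₈ =ᶠ[𝓝 x] q.z₈ := key DerivedFunctions.z₈
  have hz₉ : q'.z₉ =ᶠ[𝓝 x] q.z₉ := key DerivedFunctions.z₉
  obtain ⟨h1, h2, h3, h4, h5, h6, h7, h8, h9, h10⟩ := hq
  unfold IsDerivedAt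
  rw [hv₁.eq_of_nhds, hv₂.eq_of_nhds, hw₁.eq_of_nhds, hw₂.eq_of_nhds, hw₃.eq_of_nhds,
    hz₁.eq_of_nhds, hz₂.eq_of_nhds, hz₃.eq_of_nhds, hz₄.eq_of_nhds, hz₅.eq_of_nhds,
    hz₆.eq_of_nhds, hz₇.eq_of_nhds, hz₈.eq_of_nhds, hz₉.eq_of_nhds]
  exact ⟨h1, h2.congr_of_eventuallyEq hv₁, h3.congr_of_eventuallyEq hv₂,
    h4.congr_of_eventuallyEq hw₁, h5.congr_of_eventuallyEq hw₂, h6.congr_of_eventuallyEq hw₃,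
    h7.congr_of_eventuallyEq hz₁, h8.congr_of_eventuallyEq hz₂, h9.congr_of_eventuallyEq hz₃,
    h10.congr_of_eventuallyEq hz₄⟩

/-- In coordinates in which the coframe is explicit, the formulas define derived quantities. -/
theorem isDerivedAt_of_formulas {om : FormFamily M} {u : M → ℝ} {q : DerivedFunctions M}
    {e : OpenPartialHomeomorph M E8} (he : e ∈ IsManifold.maximalAtlas (𝓡 8) ∞ M) {h : ℝ → ℝ → ℝ}
    (hh : ContDiff ℝ ∞ (Function.uncurry h))
    (hom : ∀ y ∈ e.target, IsExplicitCoframe h (inChart e om) y)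
    (hu : ∀ y ∈ e.target, u (e.symm y) = 1 / 2 * pd h 3 0 (y 2) (y 7))
    (hq : ∀ y ∈ e.target, DerivedFormulas h q (e.symm y) y) {y : E8} (hy : y ∈ e.target) :
    IsDerivedAt om u q (e.symm y) := by
  set A := mfderiv (𝓡 8) (𝓡 8) e.symm y
  obtain ⟨-, o2, -, -, o5, -, o7, o8⟩ := hom y hy
  have p2 : ∀ v : E8, om 2 (e.symm y) (A v) = v 7 - 2 * y 4 * v 2 := fun v =>
    congrArg (fun T : E8 →L[ℝ] ℝ => T v) o2
  have p5 : ∀ v : E8, om 5 (e.symm y) (A v) = v 4 - y 1 * v 2 := fun v =>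
    congrArg (fun T : E8 →L[ℝ] ℝ => T v) o5
  have p7 : ∀ v : E8, om 7 (e.symm y) (A v) = v 2 := fun v =>
    congrArg (fun T : E8 →L[ℝ] ℝ => T v) o7
  have p8 : ∀ v : E8, om 8 (e.symm y) (A v) = v 1 := fun v =>
    congrArg (fun T : E8 →L[ℝ] ℝ => T v) o8
  have pdy : ∀ i (v : E8), dy i v = v i := fun _ _ => rfl
  have key : ∀ (f : M → ℝ) (l : List (ℝ × ℕ × ℕ × ℕ × ℕ)),
      (∀ y ∈ e.target, f (e.symm y) = derivSum h l y) →
      ∀ df : TangentSpace (𝓡 8) (e.symm y) →L[ℝ] ℝ, (∀ v : E8, df (A v) = derivSumDiff h l y v) →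
      HasDifferential f (e.symm y) df := fun f l hf df hdf =>
    hasDifferential_of_chart he hy hf (hasFDerivAt_derivSum hh l y) hdf
  unfold DerivedFormulas at hq
  have Q := hq y hy
  dsimp only at Q
  -- An entry `(c, a, b, j, k)` stands for `c y₁ᵃ y₄ᵇ` times the derivative of `h` of orders `j`,
  -- `k`; the lists are the coordinate formulas multiplied out. The quantities `z₅, …, z₉` occur
  -- only as coefficients and need no list.
  refine ⟨key _ [(1 / 2, 0, 0, 3, 0)] (fun y hy => ?_) _ fun v => ?_,
    key _ [(1 / 2, 0, 0, 3, 1)] (fun y hy => ?_) _ fun v => ?_,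
    key _ [(1 / 2, 0, 0, 4, 0), (1, 0, 1, 3, 1)] (fun y hy => ?_) _ fun v => ?_,
    key _ [(1 / 2, 0, 0, 3, 2)] (fun y hy => ?_) _ fun v => ?_,
    key _ [(1 / 2, 0, 0, 4, 1), (1, 0, 1, 3, 2)] (fun y hy => ?_) _ fun v => ?_,
    key _ [(1 / 2, 0, 0, 5, 0), (2, 0, 1, 4, 1), (2, 0, 2, 3, 2), (1, 1, 0, 3, 1)]
      (fun y hy => ?_) _ fun v => ?_,
    key _ [(1 / 2, 0, 0, 3, 3)] (fun y hy => ?_) _ fun v => ?_,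
    key _ [(1 / 2, 0, 0, 4, 2), (1, 0, 1, 3, 3)] (fun y hy => ?_) _ fun v => ?_,
    key _ [(1 / 2, 0, 0, 5, 1), (2, 0, 1, 4, 2), (2, 0, 2, 3, 3), (1, 1, 0, 3, 2)]
      (fun y hy => ?_) _ fun v => ?_,
    key _ [(1 / 2, 0, 0, 6, 0), (3, 0, 1, 5, 1), (6, 0, 2, 4, 2), (3, 1, 0, 4, 1),
      (4, 0, 3, 3, 3), (6, 1, 1, 3, 2)] (fun y hy => ?_) _ fun v => ?_⟩
  · rw [hu y hy]; simp [derivSum, derivMonomial]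
  -- Goals about values and about differentials alternate; the differentials are moved to the end
  -- and settled together.
  rotate_left
  · rw [(hq y hy).1]; simp [derivSum, derivMonomial]
  rotate_left
  · rw [(hq y hy).2.1]; simp [derivSum, derivMonomial]; ring
  rotate_left
  · rw [(hq y hy).2.2.1]; simp [derivSum, derivMonomial]
  rotate_left
  · rw [(hq y hy).2.2.2.1]; simp [derivSum, derivMonomial]; ring
  rotate_left
  · rw [(hq y hy).2.2.2.2.1]; simp [derivSum, derivMonomial]; ring
  rotate_left
  · rw [(hq y hy).2.2.2.2.2.1]; simp [derivSum, derivMonomial]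
  rotate_left
  · rw [(hq y hy).2.2.2.2.2.2.1]; simp [derivSum, derivMonomial]; ring
  rotate_left
  · rw [(hq y hy).2.2.2.2.2.2.2.1]; simp [derivSum, derivMonomial]; ring
  rotate_left
  · rw [(hq y hy).2.2.2.2.2.2.2.2.1]; simp [derivSum, derivMonomial]; ring
  rotate_left
  all_goals
    simp only [add_apply, smul_apply, p2, p5, p7, p8, smul_eq_mul, Q, derivSumDiff,
      derivMonomialDiff, List.map_cons, List.map_nil, List.sum_cons, List.sum_nil, zero_apply, pdy]
    push_cast
    ring

end Derived

/-! ### Agreement of the `D`-form and the expanded form of the formulas -/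

noncomputable section Combinations

/-- A linear combination of the derivatives of `h`, given by the list of its coefficients and
orders of differentiation. -/
def pdComb (h : ℝ → ℝ → ℝ) (l : List (ℝ × ℕ × ℕ)) : ℝ → ℝ → ℝ :=
  fun a b => (l.map fun m => m.1 * pd h m.2.1 m.2.2 a b).sum

variable {h : ℝ → ℝ → ℝ}

theorem pdComb_cons (m : ℝ × ℕ × ℕ) (l : List (ℝ × ℕ × ℕ)) (a b : ℝ) :
    pdComb h (m :: l) a b = m.1 * pd h m.2.1 m.2.2 a b + pdComb h l a b := by
  simp [pdComb]

theorem contDiff_pdComb (hh : ContDiff ℝ ∞ (Function.uncurry h)) (l : List (ℝ × ℕ × ℕ)) :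
    ContDiff ℝ ∞ (Function.uncurry (pdComb h l)) := by
  induction l with
  | nil => exact contDiff_const (c := (0 : ℝ))
  | cons m l ih =>
    have := (contDiff_const (c := m.1)).mul (contDiff_pd hh m.2.1 m.2.2) |>.add ih
    exact (funext fun p => pdComb_cons m l p.1 p.2 : Function.uncurry (pdComb h (m :: l)) = _) ▸ this

theorem pd2_pdComb (hh : ContDiff ℝ ∞ (Function.uncurry h)) (l : List (ℝ × ℕ × ℕ)) :
    pd2 (pdComb h l) = pdComb h (l.map fun m => (m.1, m.2.1 + 1, m.2.2)) := by
  ext a b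
  have hd : ∀ {f : ℝ → ℝ → ℝ}, ContDiff ℝ ∞ (Function.uncurry f) →
      DifferentiableAt ℝ (fun s => f s b) a := fun {f} hf =>
    (hf.differentiable (by simp)).comp (g := Function.uncurry f) (f := fun s : ℝ => (s, b))
      (by fun_prop) a
  induction l with
  | nil => simp [pd2, pdComb]
  | cons m l ih =>
    rw [List.map_cons, pdComb_cons, ← ih, ← pd2_pd hh]
    simp only [pd2, pdComb_cons]
    rw [deriv_fun_add ((hd (contDiff_pd hh _ _)).const_mul _) (hd (contDiff_pdComb hh l)),
      deriv_const_mul _ (hd (contDiff_pd hh _ _))]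

theorem pd7_pdComb (hh : ContDiff ℝ ∞ (Function.uncurry h)) (l : List (ℝ × ℕ × ℕ)) :
    pd7 (pdComb h l) = pdComb h (l.map fun m => (m.1, m.2.1, m.2.2 + 1)) := by
  ext a b
  have hd : ∀ {f : ℝ → ℝ → ℝ}, ContDiff ℝ ∞ (Function.uncurry f) →
      DifferentiableAt ℝ (fun s => f a s) b := fun {f} hf =>
    (hf.differentiable (by simp)).comp (g := Function.uncurry f) (f := fun s : ℝ => (a, s))
      (by fun_prop) b
  induction l with
  | nil => simp [pd7, pdComb]
  | cons m l ih =>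
    rw [List.map_cons, pdComb_cons, ← ih, ← pd7_pd]
    simp only [pd7, pdComb_cons]
    rw [deriv_fun_add ((hd (contDiff_pd hh _ _)).const_mul _) (hd (contDiff_pdComb hh l)),
      deriv_const_mul _ (hd (contDiff_pd hh _ _))]

/-- Together with the rules for `pd2` and `pd7`, this closes the combinations under `D` and under
the sums in the formulas. Here `y₁` and `y₄` are fixed parameters and enter only through the
coefficients. -/
theorem pdComb_add (c d : ℝ) (l l' : List (ℝ × ℕ × ℕ)) :
    (fun a b => c * pdComb h l a b + d * pdComb h l' a b)
      = pdComb h ((l.map fun m => (c * m.1, m.2)) ++ l'.map fun m => (d * m.1, m.2)) := by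
  ext a b
  simp only [pdComb, List.map_append, List.sum_append, List.map_map, Function.comp_def, mul_assoc,
    List.sum_map_mul_left]

theorem opD_pdComb (hh : ContDiff ℝ ∞ (Function.uncurry h)) (c : ℝ) (l : List (ℝ × ℕ × ℕ)) :
    opD c (pdComb h l) = pdComb h ((l.map fun m => (m.1, m.2.1 + 1, m.2.2))
      ++ l.map fun m => (2 * c * m.1, m.2.1, m.2.2 + 1)) := by
  have := pdComb_add (h := h) 1 (2 * c) (l.map fun m => (m.1, m.2.1 + 1, m.2.2))
    (l.map fun m => (m.1, m.2.1, m.2.2 + 1))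
  simp only [one_mul, List.map_map, Function.comp_def] at this
  rw [← this, ← pd2_pdComb hh, ← pd7_pdComb hh]
  rfl

/-- The two forms of the coordinate expressions of the derived quantities agree. -/
theorem DerivedFormulas.derivedFormulasD {M : Type*} {q : DerivedFunctions M} {x : M} {y : E8}
    (hh : ContDiff ℝ ∞ (Function.uncurry h)) (hq : DerivedFormulas h q x y) :
    DerivedFormulasD (fun a b => 1 / 2 * pd h 3 0 a b) q x y := by
  have hU : (fun a b => 1 / 2 * pd h 3 0 a b) = pdComb h [(1 / 2, 3, 0)] := by
    ext a b; simp [pdComb]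
  have h1 := fun (c : ℝ) l l' => pdComb_add (h := h) 1 c l l'
  simp only [one_mul] at h1
  unfold DerivedFormulas at hq
  unfold DerivedFormulasD
  rw [hU]
  simp only [Function.iterate_succ, Function.iterate_zero, Function.comp_def, id,
    opD_pdComb hh, pd7_pdComb hh, h1, pdComb_add, List.map_cons, List.map_nil, List.cons_append,
    List.nil_append, hq]
  simp only [pdComb, List.map_cons, List.map_nil, List.sum_cons, List.sum_nil]
  norm_num only
  refine ⟨?_, ?_, ?_, ?_, ?_, ?_, ?_, ?_, ?_, ?_, ?_, ?_, ?_, ?_⟩ <;> ring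

theorem DerivedFormulas.invariantFormulas {M : Type*} {u : M → ℝ} {q : DerivedFunctions M} {x : M}
    {y : E8} (hu : u x = 1 / 2 * pd h 3 0 (y 2) (y 7)) (hq : DerivedFormulas h q x y) :
    InvariantFormulas h u q x y := by
  unfold DerivedFormulas at hq
  unfold InvariantFormulas I₁ I₂ I₃ R
  simp only [hq, hu]
  refine ⟨?_, trivial, ?_, ?_⟩ <;> ring

end Combinations

/-! ### Gluing to global derived quantities -/

section Global

variable {M : Type*} [TopologicalSpace M] [ChartedSpace E8 M]

theorem coeff_ne_zero {t : Fin 12 → ℝ} (h0 : ∀ i, i ≠ 11 → t i = 0)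
    (hT : ∃ r : ℝ, (mainInvariant t).rootMultiplicity r = 5) : t 11 ≠ 0 := by
  intro h
  have h0' : ∀ i, t i = 0 := fun i => by
    by_cases hi : i = 11
    · rw [hi, h]
    · exact h0 i hi
  obtain ⟨r, hr⟩ := hT
  -- All coefficients being zero, the polynomial is zero, and the root multiplicity of the zero
  -- polynomial is `0` by convention, not `5`.
  simp [mainInvariant, h0'] at hr

/-- Around every point there are functions satisfying the formulas of the derived quantities. -/
theorem exists_local_derived [IsManifold (𝓡 8) ∞ M] {om : FormFamily M} {t : Fin 12 → M → ℝ}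
    (hom : IsMongeCoframe om t) (hnorm : ∀ i, i ≠ 11 → ∀ x, t i x = 0) (p : M) :
    ∃ e ∈ IsManifold.maximalAtlas (𝓡 8) ∞ M, p ∈ e.source ∧
      ∃ h : ℝ → ℝ → ℝ, ContDiff ℝ ∞ (Function.uncurry h) ∧
        (∀ y ∈ e.target, IsExplicitCoframe h (inChart e om) y ∧
          t 11 (e.symm y) = 1 / 2 * pd h 3 0 (y 2) (y 7)) ∧
        ∃ q : DerivedFunctions M, (∀ x ∈ e.source, IsDerivedAt om (t 11) q x) ∧
          ∀ y ∈ e.target, DerivedFormulas h q (e.symm y) y := by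
  obtain ⟨e, he, hp, h, hh, hc⟩ := exists_normal_chart hom hnorm p
  have hex : ∀ x : M, ∃ q : DerivedFunctions Unit, DerivedFormulas h q () (e x) := fun x =>
    -- The right-hand sides of the formulas serve as definitions; unification fills the values.
    ⟨⟨fun _ => _, fun _ => _, fun _ => _, fun _ => _, fun _ => _, fun _ => _, fun _ => _,
      fun _ => _, fun _ => _, fun _ => _, fun _ => _, fun _ => _, fun _ => _, fun _ => _⟩,
      rfl, rfl, rfl, rfl, rfl, rfl, rfl, rfl, rfl, rfl, rfl, rfl, rfl, rfl⟩
  choose Q hQ using hex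
  let q : DerivedFunctions M := ⟨fun x => (Q x).v₁ (), fun x => (Q x).v₂ (), fun x => (Q x).w₁ (),
    fun x => (Q x).w₂ (), fun x => (Q x).w₃ (), fun x => (Q x).z₁ (), fun x => (Q x).z₂ (),
    fun x => (Q x).z₃ (), fun x => (Q x).z₄ (), fun x => (Q x).z₅ (), fun x => (Q x).z₆ (),
    fun x => (Q x).z₇ (), fun x => (Q x).z₈ (), fun x => (Q x).z₉ ()⟩
  have hq : ∀ y ∈ e.target, DerivedFormulas h q (e.symm y) y := fun y hy => by
    have := hQ (e.symm y)
    rwa [e.right_inv hy] at this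
  refine ⟨e, he, hp, h, hh, hc, q, fun x hx => ?_, hq⟩
  have := isDerivedAt_of_formulas he hh (fun y hy => (hc y hy).1) (fun y hy => (hc y hy).2) hq
    (e.map_source hx)
  rwa [e.left_inv hx] at this

/-- Local families of derived quantities glue to a unique global one. -/
theorem existsUnique_isDerived {om : FormFamily M} (hli : ∀ x, LinearIndependent ℝ fun i => om i x)
    {u : M → ℝ} (hloc : ∀ p, ∃ s : Set M, IsOpen s ∧ p ∈ s ∧
      ∃ q : DerivedFunctions M, ∀ x ∈ s, IsDerivedAt om u q x) :
    ∃! q : DerivedFunctions M, IsDerived om u q := by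
  choose s hs hps Q hQ using hloc
  let q : DerivedFunctions M := ⟨fun x => (Q x).v₁ x, fun x => (Q x).v₂ x, fun x => (Q x).w₁ x,
    fun x => (Q x).w₂ x, fun x => (Q x).w₃ x, fun x => (Q x).z₁ x, fun x => (Q x).z₂ x,
    fun x => (Q x).z₃ x, fun x => (Q x).z₄ x, fun x => (Q x).z₅ x, fun x => (Q x).z₆ x,
    fun x => (Q x).z₇ x, fun x => (Q x).z₈ x, fun x => (Q x).z₉ x⟩
  refine ⟨q, fun p => ?_, fun q' hq' => ?_⟩
  -- At each `x` the global family takes the value of the local family chosen for `x`; by local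
  -- uniqueness it coincides near `p` with the family chosen for `p`, so it inherits the equations
  -- there.
  · refine (hQ p p (hps p)).congr (eventually_of_mem ((hs p).mem_nhds (hps p)) fun x hx => ?_)
    exact eval_eq_eval hli ((hs x).inter (hs p)) (fun y hy => hQ x y hy.1)
      (fun y hy => hQ p y hy.2) ⟨hps x, hx⟩
  · have key : ∀ x, q'.eval x = q.eval x := fun x =>
      eval_eq_eval hli (hs x) (fun y _ => hq' y) (fun y hy => hQ x y hy) (hps x)
    have hf : ∀ f : DerivedFunctions Unit → Unit → ℝ,
        (fun x => f (q'.eval x) ()) = fun x => f (q.eval x) () := fun f =>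
      funext fun x => by rw [key]
    cases q'
    congr 1
    exacts [hf DerivedFunctions.v₁, hf DerivedFunctions.v₂, hf DerivedFunctions.w₁,
      hf DerivedFunctions.w₂, hf DerivedFunctions.w₃, hf DerivedFunctions.z₁,
      hf DerivedFunctions.z₂, hf DerivedFunctions.z₃, hf DerivedFunctions.z₄,
      hf DerivedFunctions.z₅, hf DerivedFunctions.z₆, hf DerivedFunctions.z₇,
      hf DerivedFunctions.z₈, hf DerivedFunctions.z₉]

end Global

end MongeEight

theorem mainTheorem8 {M : Type*} [TopologicalSpace M] [ChartedSpace MongeEight.E8 M]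
    [IsManifold (𝓡 8) ∞ M]
    (om : MongeEight.FormFamily M) (t : Fin 12 → M → ℝ)
    (hom : MongeEight.IsMongeCoframe om t)
    (hT : ∀ x, ∃ r : ℝ, (MongeEight.mainInvariant (fun i => t i x)).rootMultiplicity r = 5)
    (hnorm : ∀ i, i ≠ 11 → ∀ x, t i x = 0) :
    (∃! q : MongeEight.DerivedFunctions M, MongeEight.IsDerived om (t 11) q) ∧
    ∀ p : M, ∃ e ∈ IsManifold.maximalAtlas (𝓡 8) ∞ M, p ∈ e.source ∧
      ∃ h : ℝ → ℝ → ℝ, ContDiff ℝ ∞ (Function.uncurry h) ∧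
        ∀ y ∈ e.target,
          MongeEight.IsExplicitCoframe h (MongeEight.inChart e om) y ∧
          t 11 (e.symm y) = 1 / 2 * MongeEight.pd h 3 0 (y 2) (y 7) ∧
          t 11 (e.symm y) ≠ 0 ∧
          ∀ q : MongeEight.DerivedFunctions M, MongeEight.IsDerived om (t 11) q →
            MongeEight.DerivedFormulas h q (e.symm y) y ∧
            MongeEight.DerivedFormulasD (fun a b => 1 / 2 * MongeEight.pd h 3 0 a b) q
              (e.symm y) y ∧
            MongeEight.InvariantFormulas h (t 11) q (e.symm y) y := by
  refine ⟨MongeEight.existsUnique_isDerived hom.linearIndependent fun p => ?_, fun p => ?_⟩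
  · obtain ⟨e, -, hp, -, -, -, q, hq, -⟩ := MongeEight.exists_local_derived hom hnorm p
    exact ⟨e.source, e.open_source, hp, q, hq⟩
  · obtain ⟨e, he, hp, h, hh, hc, q₀, hq₀, hf₀⟩ := MongeEight.exists_local_derived hom hnorm p
    refine ⟨e, he, hp, h, hh, fun y hy => ⟨(hc y hy).1, (hc y hy).2,
      MongeEight.coeff_ne_zero (fun i hi => hnorm i hi _) (hT _), fun q hq => ?_⟩⟩
    have heval : q₀.eval (e.symm y) = q.eval (e.symm y) :=
      MongeEight.eval_eq_eval hom.linearIndependent e.open_source hq₀ (fun x _ => hq x)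
        (e.map_target hy)
    have hf : MongeEight.DerivedFormulas h q (e.symm y) y := by
      -- The formulas involve only the values at this point, so the family may be replaced by its
      -- evaluation, where local uniqueness applies.
      change MongeEight.DerivedFormulas h (q.eval (e.symm y)) () y
      rw [← heval]
      exact hf₀ y hy
    exact ⟨hf, hf.derivedFormulasD hh, hf.invariantFormulas (hc y hy).2⟩
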